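/- Consider a single bosonic mode with Fock space $\ell^2(\mathbb N)$, number states $|n\rangle$ and mode operators $a,a^\dagger$, $[a,a^\dagger]=1$, and let $D(\gamma)=\exp\{\gamma a^\dagger-\gamma^* a\}$ for $\gamma\in\mathbb C$. A state is a positive operator of trace one. The characteristic function and the Wigner function of a state $\varrho$ are $\chi[\varrho](\gamma)=\mathrm{Tr}[\varrho D(\gamma)]$ and $W[\varrho](\alpha)=\int\frac{d^2\gamma}{\pi^2}\,e^{\gamma^*\alpha-\gamma\alpha^*}\chi[\varrho](\gamma)$. A state is Gaussian if its characteristic function is a Gaussian function, i.e. the exponential of minus a positive definite real quadratic form plus an imaginary linear form in $(\mathrm{Re}\,\gamma,\mathrm{Im}\,\gamma)$; a unit vector $\psi$ is a pure Gaussian state if $|\psi\rangle\langle\psi|$ is Gaussian. The Gaussian convex hull $\mathcal G$ is the set of states of the form $\int|\psi\rangle\langle\psi|\,d\mu(\psi)$ with $\mu$ a probability measure on the pure Gaussian states. A Gaussian map is a completely positive linear map on the trace-class operators of the mode that sends every Gaussian state to a Gaussian state; a convex mixture of Gaussian maps is a map $\mathcal E=\int\mathcal E_\omega\,dP(\omega)$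 with $P$ a probability measure and every $\mathcal E_\omega$ a Gaussian map. Let $\varrho\in\mathcal G$ and let $\mathcal E$ be a Gaussian map or a convex mixture of Gaussian maps. Then $\mathcal E(\varrho)$ is a state, the integral defining its Wigner function converges absolutely, $W[\mathcal E(\varrho)](0)$ is real, and $$W[\mathcal E(\varrho)](0)\;\ge\;\frac2\pi\exp\{-2\bar n_{\mathcal E}(1+\bar n_{\mathcal E})\},\qquad \bar n_{\mathcal E}=\mathrm{Tr}[\mathcal E(\varrho)\,a^\dagger a]\in[0,\infty],$$ where the right-hand side is read as $0$ if $\bar n_{\mathcal E}=\infty$. -/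

import Mathlib

open scoped ENNReal ComplexOrder ComplexConjugate

universe u

noncomputable section

namespace SingleMode

/-! ### The Fock space of one mode, the mode operator and the displacement operators -/

/-- The Hilbert space of a single mode (harmonic oscillator), in the number representation. -/
abbrev Fock : Type := lp (fun _ : ℕ => ℂ) 2

/-- Bounded operators on the Hilbert space of the mode. -/
abbrev Op : Type := Fock →L[ℂ] Fock

instance instMeasurableSpaceFock : MeasurableSpace Fock := borel Fock

instance instBorelSpaceFock : BorelSpace Fock := ⟨rfl⟩

/-- The number (Fock) state `|n⟩`. -/
def ket (n : ℕ) : Fock := lp.single 2 n (1 : ℂ)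

/-- Finite linear combinations of number states: the common invariant domain of `a` and `a†`. -/
abbrev FinVec : Type := ℕ →₀ ℂ

/-- The finite vector `|n⟩`. -/
def fket (n : ℕ) : FinVec := Finsupp.single n 1

/-- The inclusion of the finite vectors into the Hilbert space. -/
def incl : FinVec →ₗ[ℂ] Fock := Finsupp.linearCombination ℂ ket

/-- The mode operator: `a |n⟩ = √n |n-1⟩` (and `a |0⟩ = 0`). -/
def annihilation : FinVec →ₗ[ℂ] FinVec :=
  Finsupp.linearCombination ℂ fun n : ℕ => ((Real.sqrt n : ℝ) : ℂ) • fket (n - 1)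

/-- The adjoint mode operator: `a† |n⟩ = √(n+1) |n+1⟩`. -/
def creation : FinVec →ₗ[ℂ] FinVec :=
  Finsupp.linearCombination ℂ fun n : ℕ => ((Real.sqrt (n + 1) : ℝ) : ℂ) • fket (n + 1)

/-- The exponent `γ a† - γ* a` of the displacement operator. -/
def displacementExponent (γ : ℂ) : Module.End ℂ FinVec :=
  γ • creation - conj γ • annihilation

/-- The `k`-th term `(γ a† - γ* a)^k |n⟩ / k!` of the exponential series. -/
def displacementTerm (γ : ℂ) (n k : ℕ) : Fock :=
  ((k.factorial : ℂ)⁻¹) • incl ((displacementExponent γ ^ k) (fket n))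

/-- The vector `D(γ) |n⟩ = exp(γ a† - γ* a) |n⟩`, as an exponential series. -/
def displacedKet (γ : ℂ) (n : ℕ) : Fock := ∑' k, displacementTerm γ n k

lemma incl_fket (n : ℕ) : incl (fket n) = ket n := by
  simp [incl, fket]

lemma annihilation_fket (n : ℕ) :
    annihilation (fket n) = ((Real.sqrt n : ℝ) : ℂ) • fket (n - 1) := by
  simp [annihilation, fket]

lemma creation_fket (n : ℕ) :
    creation (fket n) = ((Real.sqrt (n + 1) : ℝ) : ℂ) • fket (n + 1) := by
  simp [creation, fket]

lemma inner_ket (m n : ℕ) : inner ℂ (ket m) (ket n) = if m = n then (1 : ℂ) else 0 := by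
  rw [ket, lp.inner_single_left, ket, lp.single_apply]
  by_cases h : m = n
  · subst h; simp
  · simp [h]

lemma norm_ket (n : ℕ) : ‖ket n‖ = 1 := by
  rw [@norm_eq_sqrt_re_inner ℂ, inner_ket]; simp

/-- Induction on finite vectors through multiples of number states. -/
lemma finVec_induction {P : FinVec → Prop} (x : FinVec) (h0 : P 0)
    (hadd : ∀ x y, P x → P y → P (x + y)) (hs : ∀ (c : ℂ) n, P (c • fket n)) : P x := by
  induction x using Finsupp.induction_linear with
  | zero => exact h0
  | add f g hf hg => exact hadd f g hf hg
  | single n c => simpa [fket] using hs c n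

lemma creation_adjoint (x y : FinVec) :
    inner ℂ (incl x) (incl (creation y)) = inner ℂ (incl (annihilation x)) (incl y) := by
  induction x using finVec_induction with
  | h0 => simp
  | hadd x x' hx hx' => simp [hx, hx']
  | hs c m =>
    induction y using finVec_induction with
    | h0 => simp
    | hadd y y' hy hy' =>
      rw [map_add, map_add, inner_add_right, hy, hy', map_add, inner_add_right]
    | hs d n =>
      simp only [map_smul, annihilation_fket, creation_fket, incl_fket, inner_smul_left,
        inner_smul_right, inner_ket, Complex.conj_ofReal]
      rcases m with _ | m
      · simp
      · by_cases h : m = n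
        · subst h; simp; left; ring
        · simp [h]

lemma displacementExponent_skew (γ : ℂ) (x y : FinVec) :
    inner ℂ (incl (displacementExponent γ x)) (incl y)
      = - inner ℂ (incl x) (incl (displacementExponent γ y)) := by
  have h1 := creation_adjoint x y
  have h2 : inner ℂ (incl (creation x)) (incl y) = inner ℂ (incl x) (incl (annihilation y)) := by
    have := congrArg conj (creation_adjoint y x)
    simpa only [inner_conj_symm] using this
  simp only [displacementExponent, LinearMap.sub_apply, LinearMap.smul_apply, map_sub, map_smul,
    inner_sub_left, inner_sub_right, inner_smul_left, inner_smul_right, Complex.conj_conj, h1, h2]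
  ring

lemma displacementExponent_pow_skew (γ : ℂ) (j : ℕ) (x y : FinVec) :
    inner ℂ (incl ((displacementExponent γ ^ j) x)) (incl y)
      = (-1) ^ j * inner ℂ (incl x) (incl ((displacementExponent γ ^ j) y)) := by
  induction j generalizing y with
  | zero => simp
  | succ j ih =>
    rw [pow_succ', Module.End.mul_apply, displacementExponent_skew, ih, ← pow_succ',
      pow_succ (displacementExponent γ) j, Module.End.mul_apply, pow_succ]
    ring

lemma norm_displacementExponent_pow_le (γ : ℂ) (k j : ℕ) :
    ‖incl ((displacementExponent γ ^ k) (fket j))‖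
      ≤ (2 * ‖γ‖) ^ k * Real.sqrt ((j + 1).ascFactorial k) := by
  induction k generalizing j with
  | zero => simp [incl_fket, norm_ket]
  | succ k ih =>
    rw [pow_succ (displacementExponent γ), Module.End.mul_apply]
    simp only [displacementExponent, LinearMap.sub_apply, LinearMap.smul_apply, creation_fket,
      annihilation_fket, map_sub, map_smul] at ih ⊢
    refine (norm_sub_le _ _).trans ?_
    simp only [norm_smul, RCLike.norm_conj, Complex.norm_real, Real.norm_eq_abs,
      abs_of_nonneg (Real.sqrt_nonneg _)]
    have hγ := norm_nonneg γ
    have e1 : Real.sqrt (j + 1) * Real.sqrt ((j + 1 + 1).ascFactorial k)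
        = Real.sqrt ((j + 1).ascFactorial (k + 1)) := by
      rw [← Real.sqrt_mul (by positivity)]
      congr 1
      have := Nat.succ_ascFactorial (j + 1) k
      rw [Nat.ascFactorial_succ, ← this]
      push_cast
      rfl
    have e2 : Real.sqrt j * Real.sqrt ((j - 1 + 1).ascFactorial k)
        ≤ Real.sqrt ((j + 1).ascFactorial (k + 1)) := by
      rw [← e1]
      gcongr <;> first | linarith | omega
    have t1 := mul_le_mul_of_nonneg_left (ih (j + 1)) (mul_nonneg hγ (Real.sqrt_nonneg (j + 1)))
    have t2 := mul_le_mul_of_nonneg_left (ih (j - 1)) (mul_nonneg hγ (Real.sqrt_nonneg j))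
    have t3 := mul_le_mul_of_nonneg_left e2 (mul_nonneg hγ (pow_nonneg (mul_nonneg zero_le_two hγ) k))
    have t4 := congrArg (fun t => ‖γ‖ * (2 * ‖γ‖) ^ k * t) e1
    rw [pow_succ]
    simp only [← mul_assoc] at t1 t2 t3 t4 ⊢
    nlinarith [t1, t2, t3, t4]

lemma summable_norm_displacementTerm (γ : ℂ) (n : ℕ) :
    Summable fun k => ‖displacementTerm γ n k‖ := by
  set c : ℝ := 2 * ‖γ‖ + 1 with hc
  have hc0 : 0 < c := by positivity
  have hpos : ∀ k, 0 < (k.factorial : ℝ)⁻¹ * (c ^ k * Real.sqrt ((n + 1).ascFactorial k)) := by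
    intro k
    have : 0 < (n + 1).ascFactorial k := Nat.ascFactorial_pos n k
    positivity
  refine Summable.of_nonneg_of_le (fun _ => norm_nonneg _) (f := fun k : ℕ =>
    (k.factorial : ℝ)⁻¹ * (c ^ k * Real.sqrt ((n + 1).ascFactorial k))) (fun k => ?_) ?_
  · rw [displacementTerm, norm_smul, norm_inv, Complex.norm_natCast]
    gcongr
    refine (norm_displacementExponent_pow_le γ k n).trans ?_
    gcongr
    simp [hc]
  · refine summable_of_ratio_test_tendsto_lt_one (l := 0) one_pos
      (Filter.Eventually.of_forall fun k => (hpos k).ne') ?_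
    have hlim : Filter.Tendsto (fun k : ℕ => c * Real.sqrt ((n + 1 : ℝ) *
        (1 / ((k : ℝ) + 1)))) Filter.atTop (nhds 0) := by
      have := (((tendsto_one_div_add_atTop_nhds_zero_nat (𝕜 := ℝ)).const_mul
        (n + 1 : ℝ)).sqrt).const_mul c
      simpa using this
    refine squeeze_zero (fun k => by positivity) (fun k => ?_) hlim
    rw [Real.norm_of_nonneg (hpos _).le, Real.norm_of_nonneg (hpos _).le, div_le_iff₀ (hpos k),
      Nat.factorial_succ, Nat.ascFactorial_succ]
    push_cast
    rw [Real.sqrt_mul (by positivity), mul_inv, pow_succ]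
    have key : ((k : ℝ) + 1)⁻¹ * Real.sqrt ((n : ℝ) + 1 + k)
        ≤ Real.sqrt ((n + 1 : ℝ) * (1 / ((k : ℝ) + 1))) := by
      apply Real.le_sqrt_of_sq_le
      rw [mul_pow, Real.sq_sqrt (by positivity)]
      rw [inv_pow, inv_mul_le_iff₀ (by positivity)]
      field_simp
      nlinarith [mul_nonneg (Nat.cast_nonneg (α := ℝ) n) (Nat.cast_nonneg (α := ℝ) k)]
    have h2 := mul_le_mul_of_nonneg_right key
      (show 0 ≤ c * ((k.factorial : ℝ)⁻¹ * (c ^ k * Real.sqrt ((n + 1).ascFactorial k)))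
        from mul_nonneg hc0.le (hpos k).le)
    refine le_trans (le_of_eq ?_) (h2.trans (le_of_eq ?_)) <;> ring

lemma hasSum_displacedKet (γ : ℂ) (n : ℕ) : HasSum (displacementTerm γ n) (displacedKet γ n) :=
  (summable_norm_displacementTerm γ n).of_norm.hasSum

/-- The vectors `D(γ) |n⟩` are orthonormal: the displacement operator is an isometry. -/
lemma orthonormal_displacedKet (γ : ℂ) : Orthonormal ℂ (displacedKet γ) := by
  rw [orthonormal_iff_ite]
  intro m n
  have hF : Summable fun p : ℕ × ℕ =>
      (inner ℂ (displacementTerm γ m p.1) (displacementTerm γ n p.2) : ℂ) := by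
    refine Summable.of_norm_bounded
      ((summable_norm_displacementTerm γ m).mul_of_nonneg (summable_norm_displacementTerm γ n)
        (fun _ => norm_nonneg _) (fun _ => norm_nonneg _)) fun p => norm_inner_le_norm _ _
  have h1 : (inner ℂ (displacedKet γ m) (displacedKet γ n) : ℂ) = ∑' p : ℕ × ℕ,
      (inner ℂ (displacementTerm γ m p.1) (displacementTerm γ n p.2) : ℂ) := by
    rw [hF.tsum_prod]
    have hr : ∀ j, ∑' k, (inner ℂ (displacementTerm γ m j) (displacementTerm γ n k) : ℂ)
        = inner ℂ (displacementTerm γ m j) (displacedKet γ n) := fun j =>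
      ((hasSum_displacedKet γ n).mapL (innerSL ℂ (displacementTerm γ m j))).tsum_eq
    simp only [hr]
    have h := (hasSum_displacedKet γ m).mapL (innerSL ℂ (displacedKet γ n))
    have h' := h.map (starRingEnd ℂ) Complex.continuous_conj
    refine (HasSum.tsum_eq ?_).symm
    simpa [Function.comp_def, inner_conj_symm] using h'
  have h2 : ∀ N : ℕ, ∑ p ∈ Finset.HasAntidiagonal.antidiagonal N,
      (inner ℂ (displacementTerm γ m p.1) (displacementTerm γ n p.2) : ℂ)
      = if N = 0 then (if m = n then 1 else 0) else 0 := by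
    intro N
    have hterm : ∀ p ∈ Finset.HasAntidiagonal.antidiagonal N,
        (inner ℂ (displacementTerm γ m p.1) (displacementTerm γ n p.2) : ℂ)
        = ((N.factorial : ℂ)⁻¹ * inner ℂ (ket m) (incl ((displacementExponent γ ^ N) (fket n)))) *
          ((-1) ^ p.1 * 1 ^ p.2 * (N.choose p.1 : ℂ)) := by
      intro p hp
      rw [Finset.HasAntidiagonal.mem_antidiagonal] at hp
      rw [displacementTerm, displacementTerm, inner_smul_left, inner_smul_right,
        displacementExponent_pow_skew, ← Module.End.mul_apply, ← pow_add, hp, incl_fket]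
      have hch : (N.choose p.1 : ℂ) = (N.factorial : ℂ) * ((p.1.factorial : ℂ)⁻¹ *
          (p.2.factorial : ℂ)⁻¹) := by
        have := Nat.add_choose_mul_factorial_mul_factorial p.1 p.2
        rw [hp, ← Nat.choose_symm_of_eq_add (by omega : N = p.1 + p.2)] at this
        have h' : (N.choose p.1 : ℂ) * p.1.factorial * p.2.factorial = N.factorial := by
          exact_mod_cast this
        have a1 : (p.1.factorial : ℂ) ≠ 0 := by exact_mod_cast p.1.factorial_ne_zero
        have a2 : (p.2.factorial : ℂ) ≠ 0 := by exact_mod_cast p.2.factorial_ne_zero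
        rw [← h']; field_simp
      have a3 : (N.factorial : ℂ) ≠ 0 := by exact_mod_cast N.factorial_ne_zero
      rw [hch]
      simp only [map_inv₀, Complex.conj_natCast, one_pow]
      field_simp
    rw [Finset.sum_congr rfl hterm, ← Finset.mul_sum]
    rw [Finset.Nat.sum_antidiagonal_eq_sum_range_succ
      (fun i j => ((-1 : ℂ) ^ i * 1 ^ j * (N.choose i : ℂ))), ← add_pow]
    rcases N with _ | N
    · simp [incl_fket, inner_ket]
    · simp
  have hF' := Finset.HasAntidiagonal.sigmaAntidiagonalEquivProd.summable_iff.mpr hF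
  rw [h1, ← Finset.HasAntidiagonal.sigmaAntidiagonalEquivProd.tsum_eq]
  have h4 := hF'.tsum_sigma' (fun N => (hasSum_fintype _).summable)
  simp only [Function.comp_apply] at h4
  rw [h4]
  have h3 : ∀ N : ℕ, ∑' p : Finset.HasAntidiagonal.antidiagonal N,
      ((inner ℂ (displacementTerm γ m (Finset.HasAntidiagonal.sigmaAntidiagonalEquivProd ⟨N, p⟩).1)
        (displacementTerm γ n (Finset.HasAntidiagonal.sigmaAntidiagonalEquivProd ⟨N, p⟩).2)) : ℂ)
      = if N = 0 then (if m = n then 1 else 0) else 0 := by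
    intro N
    rw [← h2 N, tsum_fintype, ← Finset.sum_coe_sort (Finset.HasAntidiagonal.antidiagonal N)]
    rfl
  simp only [h3, tsum_ite_eq]

/-- The displacement operator `D(γ) = exp(γ a† - γ* a)`: the bounded operator whose value at each
number state `|n⟩` is the sum of the exponential series. -/
def displacement (γ : ℂ) : Op :=
  (orthonormal_displacedKet γ).orthogonalFamily.linearIsometry.toContinuousLinearMap

lemma displacement_ket (γ : ℂ) (n : ℕ) : displacement γ (ket n) = displacedKet γ n := by
  have := (orthonormal_displacedKet γ).orthogonalFamily.linearIsometry_apply_single (i := n) 1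
  simp [displacement, ket, this]

/-! ### States, characteristic function, Wigner function, mean photon number -/

/-- The trace, computed in the number basis. -/
def trace (T : Op) : ℂ := ∑' n, inner ℂ (ket n) (T (ket n))

/-- The trace-class operators: the linear span of the positive operators of finite trace. -/
def traceClass : Submodule ℂ Op :=
  Submodule.span ℂ {T : Op | T.IsPositive ∧
    Summable fun n => (inner ℂ (ket n) (T (ket n)) : ℂ).re}

/-- Quantum states: positive operators of trace one. -/
def IsState (ρ : Op) : Prop :=
  ρ.IsPositive ∧ HasSum (fun n => (inner ℂ (ket n) (ρ (ket n)) : ℂ)) 1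

/-- The characteristic function `χ[ρ](γ) = Tr[ρ D(γ)]`. -/
def charFunction (ρ : Op) (γ : ℂ) : ℂ := trace (ρ * displacement γ)

/-- The Wigner function `W[ρ](α) = ∫ (d²γ/π²) e^{γ* α - γ α*} χ[ρ](γ)`. -/
def wigner (ρ : Op) (α : ℂ) : ℂ :=
  ∫ γ : ℂ, ((1 / Real.pi ^ 2 : ℝ) : ℂ) *
    (Complex.exp (conj γ * α - γ * conj α) * charFunction ρ γ)

/-- The mean photon number `Tr[ρ a†a]` of a state, a number in `[0, ∞]`. -/
def meanPhoton (ρ : Op) : ℝ≥0∞ :=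
  ∑' n, ENNReal.ofReal
    (inner ℂ (ket n) (ρ (incl (creation (annihilation (fket n))))) : ℂ).re

/-! ### Gaussian states and the Gaussian convex hull -/

/-- A state is Gaussian when its characteristic function is a Gaussian function, i.e. the
exponential of minus a positive definite real quadratic form plus an imaginary linear form in
`(Re γ, Im γ)`. -/
def IsGaussianState (ρ : Op) : Prop :=
  IsState ρ ∧ ∃ a b c u v : ℝ, 0 < a ∧ 0 < a * c - b ^ 2 ∧ ∀ γ : ℂ,
    charFunction ρ γ = Complex.exp
      (-((a * γ.re ^ 2 + 2 * b * γ.re * γ.im + c * γ.im ^ 2 : ℝ) : ℂ)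
        + Complex.I * ((u * γ.re + v * γ.im : ℝ) : ℂ))

/-- The projector `|ψ⟩⟨ψ|`. -/
def proj (ψ : Fock) : Op := InnerProductSpace.rankOne ℂ ψ ψ

/-- A unit vector is a pure Gaussian state when its projector is a Gaussian state. -/
def IsPureGaussian (ψ : Fock) : Prop := ‖ψ‖ = 1 ∧ IsGaussianState (proj ψ)

/-- The Gaussian convex hull: the states of the form `∫ |ψ⟩⟨ψ| dμ(ψ)` with `μ` a probability
measure on pure Gaussian states. -/
def gaussianHull : Set Op :=
  {ρ | IsState ρ ∧ ∃ μ : MeasureTheory.Measure Fock, MeasureTheory.IsProbabilityMeasure μ ∧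
    (∀ᵐ ψ ∂μ, IsPureGaussian ψ) ∧ ρ = ∫ ψ, proj ψ ∂μ}

/-! ### Gaussian maps and their mixtures -/

/-- Complete positivity of a linear map on the trace-class operators: for every `n`, it sends
positive `n × n` block operators to positive `n × n` block operators. -/
def IsCompletelyPositive (E : traceClass →ₗ[ℂ] traceClass) : Prop :=
  ∀ (n : ℕ) (T : Fin n → Fin n → traceClass),
    (∀ v : Fin n → Fock, (0 : ℂ) ≤ ∑ i, ∑ j, inner ℂ (v i) ((T i j : Op) (v j))) →
    ∀ v : Fin n → Fock, (0 : ℂ) ≤ ∑ i, ∑ j, inner ℂ (v i) ((E (T i j) : Op) (v j))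

/-- A Gaussian map: a completely positive map that transforms Gaussian states into Gaussian
states (so it preserves the trace of Gaussian states). -/
def IsGaussianMap (E : traceClass →ₗ[ℂ] traceClass) : Prop :=
  IsCompletelyPositive E ∧
    ∀ ρ : traceClass, IsGaussianState (ρ : Op) → IsGaussianState (E ρ : Op)

/-- A convex mixture `E = ∫ F_ω dP(ω)` of Gaussian maps over an arbitrary probability space; the
integral is taken entrywise. -/
def IsGaussianMapMixture (E : traceClass →ₗ[ℂ] traceClass) : Prop :=
  ∃ (Ω : Type u) (_ : MeasurableSpace Ω) (P : MeasureTheory.Measure Ω)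
    (F : Ω → traceClass →ₗ[ℂ] traceClass),
    MeasureTheory.IsProbabilityMeasure P ∧ (∀ ω, IsGaussianMap (F ω)) ∧
    ∀ (T : traceClass) (x y : Fock),
      MeasureTheory.Integrable (fun ω => (inner ℂ x ((F ω T : Op) y) : ℂ)) P ∧
      inner ℂ x ((E T : Op) y) = ∫ ω, (inner ℂ x ((F ω T : Op) y) : ℂ) ∂P

end SingleMode

end

open SingleMode

/-!
The Wigner function at the origin is linear in the state, so a lower bound that is convex in the
mean photon number passes from Gaussian states to their mixtures. It remains to prove the bound for
Gaussian states and to justify that `E(ρ)` is a mixture of Gaussian states.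

For a Gaussian state with characteristic function `exp (-Q + i w)`, where `Q` has matrix
`[[a, b], [b, c]]` and `w = (u, v)`, a Gaussian integral gives
`W(0) = exp (-(c u² - 2 b u v + a v²) / (4 D)) / (π √D)` with `D = a c - b²`. Positivity of the
state yields the uncertainty relation `D ≥ 1/4` (`uncertainty_relation`): `Tr[ρ X†X] ≥ 0` is tested on
combinations `X` of three nearby displacements, whose products are known from the Weyl relation
(`adjoint_displacement_mul`). The mean photon number is at least `(a + c - 1) / 2 + (u² + v²) / 4`
(`le_two_mul_meanPhoton_add_one`), because a displacement `D(γ)` moves a vector by no more than the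
norm of its image under `γ a† - γ* a`. These two facts imply the bound for Gaussian states
(`gaussian_bound`), and `D ≥ 1/4` also bounds the `L¹` norm of the characteristic function by `2 π`
uniformly over Gaussian states.

For mixtures, `IsEntrywiseIntegral.hasWignerBound` shows that the bound is inherited by entrywise
integrals: the uniform `L¹` bound justifies Fubini's theorem, and `n ↦ exp (-2 n (1 + n))` is convex
on `[0, ∞)`. A completely positive map has to commute with the integral defining an element of the
Gaussian hull. That integral converges in the operator norm, while the map is only
given as a linear map on the trace class; but positive functionals on the trace class are
automatically of the form `T ↦ Tr[T A]` with `A` bounded (`exists_trace_representation`), and these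
do commute with the integral (`map_mixture_eq_integral`).
-/

noncomputable section

namespace SingleMode

/-! ### Positive operators of finite trace -/

/-- A positive operator on a Hilbert space has a self-adjoint square root. -/
lemma exists_isSelfAdjoint_mul_self_eq {H : Type*} [NormedAddCommGroup H] [InnerProductSpace ℂ H]
    [CompleteSpace H] {T : H →L[ℂ] H} (hT : T.IsPositive) :
    ∃ s : H →L[ℂ] H, IsSelfAdjoint s ∧ s * s = T :=
  ⟨CFC.sqrt T, (CFC.sqrt_nonneg T).isSelfAdjoint,
    CFC.sqrt_mul_sqrt_self T ((ContinuousLinearMap.nonneg_iff_isPositive T).mpr hT)⟩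

lemma inner_map_comm {s : Op} (hs : IsSelfAdjoint s) (x y : Fock) :
    inner ℂ (s x) y = inner ℂ x (s y) := by
  rw [← ContinuousLinearMap.adjoint_inner_right, ← ContinuousLinearMap.star_eq_adjoint,
    hs.star_eq]

lemma inner_ket_left (n : ℕ) (x : Fock) : inner ℂ (ket n) x = x n := by
  rw [ket, lp.inner_single_left]; simp

lemma inner_ket_right (n : ℕ) (x : Fock) : inner ℂ x (ket n) = conj (x n) := by
  rw [← inner_conj_symm, inner_ket_left]

lemma hasSum_inner_mul_inner_ket (x y : Fock) :
    HasSum (fun n => inner ℂ x (ket n) * inner ℂ (ket n) y) (inner ℂ x y) := by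
  refine (lp.hasSum_inner x y).congr_fun fun n => ?_
  rw [inner_ket_left, inner_ket_right, RCLike.inner_apply, mul_comm]

lemma re_inner_mul_inner_swap (x y : Fock) :
    (inner ℂ x y * inner ℂ y x : ℂ).re = ‖(inner ℂ y x : ℂ)‖ ^ 2 := by
  rw [← inner_conj_symm x y, ← Complex.normSq_eq_conj_mul_self, Complex.ofReal_re,
    Complex.normSq_eq_norm_sq]

lemma hasSum_norm_sq_inner_ket (x : Fock) :
    HasSum (fun n => ‖(inner ℂ (ket n) x : ℂ)‖ ^ 2) (‖x‖ ^ 2) := by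
  have h := (hasSum_inner_mul_inner_ket x x).mapL Complex.reCLM
  convert h using 2 with n
  · exact (re_inner_mul_inner_swap x (ket n)).symm
  · simp [← Complex.ofReal_pow]

/-- The diagonal matrix element `⟨n|T|n⟩`: the photon-number probability of a state `T`. -/
def diagEntry (T : Op) (n : ℕ) : ℝ := (inner ℂ (ket n) (T (ket n)) : ℂ).re

lemma inner_mul_self {s : Op} (hs : IsSelfAdjoint s) (x y : Fock) :
    inner ℂ x ((s * s) y) = inner ℂ (s x) (s y) := by
  rw [mul_apply_eq_comp, inner_map_comm hs]

lemma diagEntry_mul_self {s : Op} (hs : IsSelfAdjoint s) (n : ℕ) :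
    diagEntry (s * s) n = ‖s (ket n)‖ ^ 2 := by
  rw [diagEntry, inner_mul_self hs]
  simp [← Complex.ofReal_pow]

lemma diagEntry_nonneg {T : Op} (hT : T.IsPositive) (n : ℕ) : 0 ≤ diagEntry T n :=
  hT.re_inner_nonneg_right _

lemma norm_mul_le_half_add_sq (a b : ℂ) : ‖a * b‖ ≤ (‖a‖ ^ 2 + ‖b‖ ^ 2) / 2 := by
  rw [norm_mul]; nlinarith [sq_nonneg (‖a‖ - ‖b‖)]

lemma norm_inner_map_ket (B : Op) (x : Fock) (n : ℕ) :
    ‖(inner ℂ x (B (ket n)) : ℂ)‖ = ‖(inner ℂ (ket n) (ContinuousLinearMap.adjoint B x) : ℂ)‖ := by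
  rw [ContinuousLinearMap.adjoint_inner_right, norm_inner_symm]

section HilbertSchmidt

variable {s : Op}

lemma hasSum_traceArray_bound (B : Op) (k : ℕ) :
    HasSum (fun n => (‖(inner ℂ (s (ket k)) (B (ket n)) : ℂ)‖ ^ 2
      + ‖(inner ℂ (ket n) (s (ket k)) : ℂ)‖ ^ 2) / 2)
      ((‖ContinuousLinearMap.adjoint B (s (ket k))‖ ^ 2 + ‖s (ket k)‖ ^ 2) / 2) := by
  simp only [norm_inner_map_ket B]
  exact ((hasSum_norm_sq_inner_ket _).add (hasSum_norm_sq_inner_ket _)).div_const 2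

lemma norm_adjoint_apply_sq_le {B : Op} {C : ℝ} (hB : ‖B‖ ≤ C) (x : Fock) :
    ‖ContinuousLinearMap.adjoint B x‖ ^ 2 ≤ C ^ 2 * ‖x‖ ^ 2 := by
  rw [← mul_pow]
  gcongr
  refine (ContinuousLinearMap.le_opNorm _ _).trans ?_
  rw [LinearIsometryEquiv.norm_map]
  gcongr

/-- The double array `⟨k|s B|n⟩⟨n|s|k⟩`, whose two iterated sums are `Tr[s² B]` and
`∑ₖ ⟨s k|B|s k⟩`, is absolutely summable when `s` is Hilbert–Schmidt. -/
lemma summable_norm_traceArray (hsum : Summable fun n => ‖s (ket n)‖ ^ 2) (B : Op) :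
    Summable fun p : ℕ × ℕ =>
      ‖(inner ℂ (s (ket p.1)) (B (ket p.2)) * inner ℂ (ket p.2) (s (ket p.1)) : ℂ)‖ := by
  have hb : Summable fun p : ℕ × ℕ => (‖(inner ℂ (s (ket p.1)) (B (ket p.2)) : ℂ)‖ ^ 2
      + ‖(inner ℂ (ket p.2) (s (ket p.1)) : ℂ)‖ ^ 2) / 2 := by
    rw [summable_prod_of_nonneg (fun p => by positivity)]
    refine ⟨fun k => (hasSum_traceArray_bound B k).summable, ?_⟩
    simp only [fun k => (hasSum_traceArray_bound (s := s) B k).tsum_eq]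
    refine Summable.div_const (Summable.add ?_ hsum) 2
    exact Summable.of_nonneg_of_le (fun _ => by positivity)
      (fun k => norm_adjoint_apply_sq_le le_rfl _) (hsum.mul_left (‖B‖ ^ 2))
  exact hb.of_nonneg_of_le (fun _ => norm_nonneg _) fun p => norm_mul_le_half_add_sq _ _

lemma hasSum_traceArray_right (B : Op) (k : ℕ) :
    HasSum (fun n => (inner ℂ (s (ket k)) (B (ket n)) * inner ℂ (ket n) (s (ket k)) : ℂ))
      (inner ℂ (s (ket k)) (B (s (ket k)))) := by
  have h := hasSum_inner_mul_inner_ket (ContinuousLinearMap.adjoint B (s (ket k))) (s (ket k))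
  simpa only [ContinuousLinearMap.adjoint_inner_left] using h

lemma hasSum_traceArray_left (hs : IsSelfAdjoint s) (B : Op) (n : ℕ) :
    HasSum (fun k => (inner ℂ (s (ket k)) (B (ket n)) * inner ℂ (ket n) (s (ket k)) : ℂ))
      (inner ℂ (ket n) ((s * s) (B (ket n)))) := by
  have h := hasSum_inner_mul_inner_ket (s (ket n)) (s (B (ket n)))
  rw [inner_mul_self hs]
  convert h using 2 with k
  rw [inner_map_comm hs, ← inner_map_comm hs (ket n), mul_comm]

/-- Cyclicity of the trace in the form `Tr[s² B] = ∑ₖ ⟨s k|B|s k⟩`. -/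
lemma hasSum_inner_mul_self (hs : IsSelfAdjoint s) (hsum : Summable fun n => ‖s (ket n)‖ ^ 2)
    (B : Op) :
    HasSum (fun k => (inner ℂ (s (ket k)) (B (s (ket k))) : ℂ)) (trace (s * s * B)) := by
  have hF := (summable_norm_traceArray hsum B).of_norm
  have h1 := hF.hasSum.prod_fiberwise (fun k => hasSum_traceArray_right B k)
  have h2 := ((Equiv.prodComm ℕ ℕ).hasSum_iff.mpr hF.hasSum).prod_fiberwise
    (fun n => hasSum_traceArray_left hs B n)
  have : trace (s * s * B) = _ := h2.tsum_eq
  rw [this]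
  exact h1

lemma summable_norm_inner_mul_self (hs : IsSelfAdjoint s)
    (hsum : Summable fun n => ‖s (ket n)‖ ^ 2) (B : Op) :
    Summable fun n => ‖(inner ℂ (ket n) ((s * s) (B (ket n))) : ℂ)‖ := by
  have hF := summable_norm_traceArray hsum B
  have hG := (Equiv.prodComm ℕ ℕ).summable_iff.mpr hF
  refine Summable.of_nonneg_of_le (fun _ => norm_nonneg _) (fun n => ?_) hG.prod
  rw [← (hasSum_traceArray_left hs B n).tsum_eq]
  exact norm_tsum_le_tsum_norm (hG.prod_factor n)

lemma tsum_norm_inner_mul_self_le (hs : IsSelfAdjoint s)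
    (hsum : Summable fun n => ‖s (ket n)‖ ^ 2) {B : Op} (hB : ‖B‖ ≤ 1) :
    ∑' n, ‖(inner ℂ (ket n) ((s * s) (B (ket n))) : ℂ)‖ ≤ ∑' n, ‖s (ket n)‖ ^ 2 := by
  have hF := summable_norm_traceArray hsum B
  have hG := (Equiv.prodComm ℕ ℕ).summable_iff.mpr hF
  calc ∑' n, ‖(inner ℂ (ket n) ((s * s) (B (ket n))) : ℂ)‖
      ≤ ∑' n, ∑' k, ‖(inner ℂ (s (ket k)) (B (ket n)) * inner ℂ (ket n) (s (ket k)) : ℂ)‖ := by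
        refine (summable_norm_inner_mul_self hs hsum B).tsum_le_tsum (fun n => ?_) hG.prod
        rw [← (hasSum_traceArray_left hs B n).tsum_eq]
        exact norm_tsum_le_tsum_norm (hG.prod_factor n)
    _ = ∑' k, ∑' n, ‖(inner ℂ (s (ket k)) (B (ket n)) * inner ℂ (ket n) (s (ket k)) : ℂ)‖ :=
        Summable.tsum_comm hF
    _ ≤ ∑' k, ‖s (ket k)‖ ^ 2 := by
        refine hF.prod.tsum_le_tsum (fun k => ?_) hsum
        refine ((hF.prod_factor k).tsum_le_tsum (fun n => norm_mul_le_half_add_sq _ _)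
          (hasSum_traceArray_bound B k).summable).trans ?_
        rw [(hasSum_traceArray_bound B k).tsum_eq]
        have := norm_adjoint_apply_sq_le hB (s (ket k))
        linarith

lemma norm_apply_sq_le_of_hilbertSchmidt (hs : IsSelfAdjoint s)
    (hsum : Summable fun n => ‖s (ket n)‖ ^ 2) (x : Fock) :
    ‖s x‖ ^ 2 ≤ (∑' n, ‖s (ket n)‖ ^ 2) * ‖x‖ ^ 2 := by
  rw [← (hasSum_norm_sq_inner_ket (s x)).tsum_eq, ← tsum_mul_right]
  refine (hasSum_norm_sq_inner_ket (s x)).summable.tsum_le_tsum (fun n => ?_)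
    (hsum.mul_right _)
  rw [← inner_map_comm hs, ← mul_pow]
  gcongr
  exact norm_inner_le_norm _ _

/-- The operator norm of a positive operator is at most its trace. -/
lemma norm_mul_self_le (hs : IsSelfAdjoint s) (hsum : Summable fun n => ‖s (ket n)‖ ^ 2) :
    ‖s * s‖ ≤ ∑' n, ‖s (ket n)‖ ^ 2 := by
  have h0 : 0 ≤ ∑' n, ‖s (ket n)‖ ^ 2 := tsum_nonneg fun _ => by positivity
  have h1 : ‖s‖ ≤ Real.sqrt (∑' n, ‖s (ket n)‖ ^ 2) := by
    refine ContinuousLinearMap.opNorm_le_bound _ (Real.sqrt_nonneg _) fun x => ?_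
    rw [← Real.sqrt_sq (norm_nonneg x), ← Real.sqrt_mul h0]
    exact Real.le_sqrt_of_sq_le (norm_apply_sq_le_of_hilbertSchmidt hs hsum x)
  calc ‖s * s‖ ≤ ‖s‖ * ‖s‖ := norm_mul_le _ _
    _ ≤ Real.sqrt (∑' n, ‖s (ket n)‖ ^ 2) * Real.sqrt (∑' n, ‖s (ket n)‖ ^ 2) := by gcongr
    _ = _ := Real.mul_self_sqrt h0

end HilbertSchmidt

/-- A positive operator of finite trace. -/
def IsPositiveTraceClass (T : Op) : Prop := T.IsPositive ∧ Summable (diagEntry T)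

/-- A positive operator of finite trace is the square of a self-adjoint Hilbert–Schmidt operator. -/
lemma IsPositiveTraceClass.exists_sqrt {T : Op} (hT : IsPositiveTraceClass T) :
    ∃ s : Op, IsSelfAdjoint s ∧ (∀ n, diagEntry T n = ‖s (ket n)‖ ^ 2) ∧
      (Summable fun n => ‖s (ket n)‖ ^ 2) ∧ s * s = T := by
  obtain ⟨s, hs, rfl⟩ := exists_isSelfAdjoint_mul_self_eq hT.1
  exact ⟨s, hs, diagEntry_mul_self hs,
    hT.2.congr (diagEntry_mul_self hs), rfl⟩

lemma IsPositiveTraceClass.mem {T : Op} (hT : IsPositiveTraceClass T) : T ∈ traceClass :=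
  Submodule.subset_span hT

lemma IsState.isPositiveTraceClass {ρ : Op} (hρ : IsState ρ) : IsPositiveTraceClass ρ :=
  ⟨hρ.1, (hρ.2.mapL Complex.reCLM).summable⟩

lemma IsState.hasSum_diagEntry {ρ : Op} (hρ : IsState ρ) : HasSum (diagEntry ρ) 1 :=
  hρ.2.mapL Complex.reCLM

lemma IsPositiveTraceClass.norm_le {T : Op} (hT : IsPositiveTraceClass T) :
    ‖T‖ ≤ ∑' n, diagEntry T n := by
  obtain ⟨s, hs, hd, hsum, rfl⟩ := hT.exists_sqrt
  simpa only [hd] using norm_mul_self_le hs hsum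

lemma diagEntry_proj (ψ : Fock) (n : ℕ) :
    diagEntry (proj ψ) n = ‖(inner ℂ (ket n) ψ : ℂ)‖ ^ 2 := by
  rw [diagEntry, proj, InnerProductSpace.rankOne_apply, inner_smul_right, re_inner_mul_inner_swap]

lemma hasSum_diagEntry_proj (ψ : Fock) : HasSum (diagEntry (proj ψ)) (‖ψ‖ ^ 2) :=
  (hasSum_norm_sq_inner_ket ψ).congr_fun (diagEntry_proj ψ)

lemma isPositiveTraceClass_proj (ψ : Fock) : IsPositiveTraceClass (proj ψ) :=
  ⟨InnerProductSpace.isPositive_rankOne_self ψ, (hasSum_diagEntry_proj ψ).summable⟩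

/-! ### Positive functionals on the trace class -/

lemma isPositive_of_inner_nonneg {T : Op} (h : ∀ x, (0 : ℂ) ≤ inner ℂ x (T x)) :
    T.IsPositive := by
  rw [ContinuousLinearMap.isPositive_iff_complex]
  intro x
  rw [← inner_conj_symm, Complex.conj_eq_iff_im.mpr (Complex.le_def.mp (h x)).2.symm]
  obtain ⟨h1, h2⟩ := Complex.le_def.mp (h x)
  exact ⟨Complex.ext rfl (by simpa using h2), by simpa using h1⟩

lemma hasSum_inner_apply {ι : Type*} {U : ι → Op} {S : Op} (h : HasSum U S) (x y : Fock) :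
    HasSum (fun i => (inner ℂ x (U i y) : ℂ)) (inner ℂ x (S y)) :=
  (h.mapL (ContinuousLinearMap.apply ℂ Fock y)).mapL (innerSL ℂ x)

/-- A series of positive operators with summable traces converges to a positive operator of finite
trace, which dominates each of its terms. -/
lemma exists_isPositiveTraceClass_dominating {U : ℕ → Op} (hU : ∀ n, IsPositiveTraceClass (U n))
    (hsum : Summable fun n => ∑' k, diagEntry (U n) k) :
    ∃ S : Op, IsPositiveTraceClass S ∧ ∀ n, (S - U n).IsPositive := by
  have hs : Summable U := Summable.of_norm_bounded hsum fun n => (hU n).norm_le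
  have hp : ∀ n x, (0 : ℂ) ≤ inner ℂ x (U n x) := fun n x => (hU n).1.inner_nonneg_right x
  refine ⟨∑' n, U n, ⟨isPositive_of_inner_nonneg fun x =>
    (hasSum_inner_apply hs.hasSum x x).nonneg (hp · x), ?_⟩, fun n =>
    isPositive_of_inner_nonneg fun x => ?_⟩
  · have h1 : Summable fun p : ℕ × ℕ => diagEntry (U p.1) p.2 := by
      rw [summable_prod_of_nonneg fun p => diagEntry_nonneg (hU p.1).1 p.2]
      exact ⟨fun n => (hU n).2, hsum⟩
    refine ((Equiv.prodComm ℕ ℕ).summable_iff.mpr h1).prod.congr fun k => ?_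
    exact ((hasSum_inner_apply hs.hasSum (ket k) (ket k)).mapL Complex.reCLM).tsum_eq
  · rw [sub_apply, inner_sub_right, sub_nonneg]
    exact le_hasSum (hasSum_inner_apply hs.hasSum x x) n fun j _ => hp j x

lemma diagEntry_smul (c : ℝ) (T : Op) (n : ℕ) :
    diagEntry ((c : ℂ) • T) n = c * diagEntry T n := by
  rw [diagEntry, smul_apply, inner_smul_right, Complex.re_ofReal_mul, diagEntry]

lemma IsPositiveTraceClass.smul {T : Op} (hT : IsPositiveTraceClass T) {c : ℝ} (hc : 0 ≤ c) :
    IsPositiveTraceClass ((c : ℂ) • T) := by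
  refine ⟨hT.1.smul_of_nonneg (by exact_mod_cast hc), ?_⟩
  exact (hT.2.mul_left c).congr fun n => (diagEntry_smul c T n).symm

variable {φ : traceClass →ₗ[ℂ] ℂ}

/-- Automatic continuity: a positive functional on the trace class is bounded for the trace norm.
Otherwise a series of positive operators with traces `2⁻ⁿ` on which the functional exceeds `2ⁿ`
would have an infinite value. -/
lemma exists_bound_of_positive (hφ : ∀ T : traceClass, (T : Op).IsPositive → 0 ≤ φ T) :
    ∃ C : ℝ, 0 ≤ C ∧ ∀ T : traceClass, IsPositiveTraceClass (T : Op) →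
      (φ T).re ≤ C * ∑' n, diagEntry (T : Op) n := by
  by_contra! hcon
  choose T hT hlt using fun n : ℕ => hcon (4 ^ n) (by positivity)
  have htr : ∀ n, 0 < ∑' k, diagEntry (T n : Op) k := by
    intro n
    refine lt_of_le_of_ne (tsum_nonneg (diagEntry_nonneg (hT n).1)) fun h0 => ?_
    have h1 : (T n : Op) = 0 := norm_le_zero_iff.mp (h0 ▸ (hT n).norm_le)
    have h2 := hlt n
    rw [← h0, Subtype.ext (a2 := (0 : traceClass)) h1] at h2
    simp at h2
  set c : ℕ → ℝ := fun n => (2 ^ n * ∑' k, diagEntry (T n : Op) k)⁻¹ with hc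
  have hc0 : ∀ n, 0 < c n := fun n => inv_pos.mpr (mul_pos (by positivity) (htr n))
  have htrU : ∀ n, ∑' k, diagEntry ((c n : ℂ) • (T n : Op)) k = (1 / 2) ^ n := by
    intro n
    simp only [diagEntry_smul, tsum_mul_left, hc]
    have := (htr n).ne'
    field_simp
    rw [← mul_pow]; norm_num
  obtain ⟨S, hS, hdom⟩ := exists_isPositiveTraceClass_dominating
    (U := fun n => (c n : ℂ) • (T n : Op)) (fun n => (hT n).smul (hc0 n).le)
    (by simpa only [htrU] using summable_geometric_two)
  have hbig : ∀ n : ℕ, (2 : ℝ) ^ n ≤ (φ ⟨S, hS.mem⟩).re := by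
    intro n
    have h1 : 0 ≤ φ (⟨S, hS.mem⟩ - (c n : ℂ) • T n) := by
      refine hφ _ ?_
      rw [Submodule.coe_sub, Submodule.coe_smul]
      exact hdom n
    rw [map_sub, map_smul, sub_nonneg, Complex.le_def] at h1
    refine le_trans ?_ h1.1
    rw [smul_eq_mul, Complex.re_ofReal_mul]
    have h2 := mul_le_mul_of_nonneg_left (hlt n).le (hc0 n).le
    refine le_trans (le_of_eq ?_) h2
    simp only [hc]
    have := (htr n).ne'
    field_simp
    rw [← pow_mul, mul_comm, pow_mul]; norm_num
  obtain ⟨n, hn⟩ := pow_unbounded_of_one_lt (φ ⟨S, hS.mem⟩).re one_lt_two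
  exact absurd (hbig n) (not_le.mpr hn)

lemma diagEntry_sub (S T : Op) (n : ℕ) : diagEntry (S - T) n = diagEntry S n - diagEntry T n := by
  simp [diagEntry]

lemma diagEntry_sum {ι : Type*} (F : Finset ι) (T : ι → Op) (n : ℕ) :
    diagEntry (∑ i ∈ F, T i) n = ∑ i ∈ F, diagEntry (T i) n := by
  simp [diagEntry]

lemma inner_proj_apply_self (ψ x : Fock) :
    (inner ℂ x (proj ψ x) : ℂ) = ((‖(inner ℂ ψ x : ℂ)‖ ^ 2 : ℝ) : ℂ) := by
  rw [proj, InnerProductSpace.rankOne_apply, inner_smul_right, ← inner_conj_symm x ψ,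
    Complex.mul_conj, Complex.normSq_eq_norm_sq]

/-- The remainder of the expansion `s² = ∑ₙ |s n⟩⟨s n|` is positive and its trace is the tail of
the trace of `s²`. -/
lemma isPositiveTraceClass_remainder {s : Op} (hs : IsSelfAdjoint s)
    (hsum : Summable fun n => ‖s (ket n)‖ ^ 2) (N : ℕ) :
    IsPositiveTraceClass (s * s - ∑ n ∈ Finset.range N, proj (s (ket n))) ∧
      ∑' k, diagEntry (s * s - ∑ n ∈ Finset.range N, proj (s (ket n))) k
        = ∑' k, ‖s (ket k)‖ ^ 2 - ∑ n ∈ Finset.range N, ‖s (ket n)‖ ^ 2 := by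
  have hd : HasSum (diagEntry (s * s - ∑ n ∈ Finset.range N, proj (s (ket n))))
      (∑' k, ‖s (ket k)‖ ^ 2 - ∑ n ∈ Finset.range N, ‖s (ket n)‖ ^ 2) := by
    refine (hsum.hasSum.sub (hasSum_sum fun n _ => hasSum_diagEntry_proj (s (ket n)))).congr_fun
      fun k => ?_
    rw [diagEntry_sub, diagEntry_sum, diagEntry_mul_self hs]
  refine ⟨⟨isPositive_of_inner_nonneg fun x => ?_, hd.summable⟩, hd.tsum_eq⟩
  rw [sub_apply, sum_apply, inner_sub_right, inner_sum,
    inner_mul_self hs, inner_self_eq_norm_sq_to_K]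
  simp only [inner_proj_apply_self, inner_map_comm hs]
  have := sum_le_hasSum (Finset.range N) (fun _ _ => by positivity)
    (hasSum_norm_sq_inner_ket (s x))
  have h2 : (0 : ℝ) ≤ ‖s x‖ ^ 2 - ∑ n ∈ Finset.range N, ‖(inner ℂ (ket n) (s x) : ℂ)‖ ^ 2 := by
    linarith
  rw [← Complex.zero_le_real] at h2
  push_cast at h2 ⊢
  exact h2

lemma rankOne_polarization (w v : Fock) :
    InnerProductSpace.rankOne ℂ w v = (1 / 4 : ℂ) • (proj (w + v) - proj (w - v)
      + Complex.I • proj (w + Complex.I • v) - Complex.I • proj (w - Complex.I • v)) := by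
  ext1 x
  simp only [proj, smul_apply, add_apply, sub_apply, InnerProductSpace.rankOne_apply,
    inner_add_left, inner_sub_left, inner_smul_left, Complex.conj_I]
  match_scalars <;> ring_nf <;> simp <;> ring

lemma rankOne_mem_traceClass (w v : Fock) : InnerProductSpace.rankOne ℂ w v ∈ traceClass := by
  have h := fun ψ => (isPositiveTraceClass_proj ψ).mem
  rw [rankOne_polarization]
  exact traceClass.smul_mem _ (sub_mem (add_mem (sub_mem (h _) (h _))
    (traceClass.smul_mem _ (h _))) (traceClass.smul_mem _ (h _)))

/-- The projector `|ψ⟩⟨ψ|` as an element of the trace class. -/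
def projTC (ψ : Fock) : traceClass := ⟨proj ψ, (isPositiveTraceClass_proj ψ).mem⟩

/-- The operator `|w⟩⟨v|` as an element of the trace class. -/
def rankOneTC (w v : Fock) : traceClass :=
  ⟨InnerProductSpace.rankOne ℂ w v, rankOne_mem_traceClass w v⟩

lemma rankOneTC_polarization (w v : Fock) :
    rankOneTC w v = (1 / 4 : ℂ) • (projTC (w + v) - projTC (w - v)
      + Complex.I • projTC (w + Complex.I • v) - Complex.I • projTC (w - Complex.I • v)) :=
  Subtype.ext (rankOne_polarization w v)

lemma norm_map_projTC_le (hφ : ∀ T : traceClass, (T : Op).IsPositive → 0 ≤ φ T) {C : ℝ}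
    (hC : ∀ T : traceClass, IsPositiveTraceClass (T : Op) →
      (φ T).re ≤ C * ∑' n, diagEntry (T : Op) n) (ψ : Fock) :
    ‖φ (projTC ψ)‖ ≤ C * ‖ψ‖ ^ 2 := by
  have h1 := hφ (projTC ψ) (isPositiveTraceClass_proj ψ).1
  have h2 := hC (projTC ψ) (isPositiveTraceClass_proj ψ)
  rw [show ∑' n, diagEntry (projTC ψ : Op) n = ‖ψ‖ ^ 2 from (hasSum_diagEntry_proj ψ).tsum_eq] at h2
  rwa [← Complex.re_eq_norm.mpr h1]

/-- By polarization and rescaling, the form `(v, w) ↦ φ(|w⟩⟨v|)` is bounded. -/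
lemma norm_map_rankOneTC_le (hφ : ∀ T : traceClass, (T : Op).IsPositive → 0 ≤ φ T) {C : ℝ}
    (hC : ∀ T : traceClass, IsPositiveTraceClass (T : Op) →
      (φ T).re ≤ C * ∑' n, diagEntry (T : Op) n) (w v : Fock) :
    ‖φ (rankOneTC w v)‖ ≤ 2 * C * ‖v‖ * ‖w‖ := by
  have hsq : ∀ w v : Fock, ‖φ (rankOneTC w v)‖ ≤ C * (‖w‖ ^ 2 + ‖v‖ ^ 2) := by
    intro w v
    have hb := norm_map_projTC_le hφ hC
    have p1 := parallelogram_law_with_norm ℂ w v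
    have p2 := parallelogram_law_with_norm ℂ w (Complex.I • v)
    rw [norm_smul, Complex.norm_I, one_mul] at p2
    rw [rankOneTC_polarization]
    simp only [map_smul, map_sub, map_add, smul_eq_mul, norm_mul]
    have ht : ∀ a b c d : ℂ, ‖a - b + Complex.I * c - Complex.I * d‖ ≤ ‖a‖ + ‖b‖ + ‖c‖ + ‖d‖ := by
      intro a b c d
      refine (norm_sub_le _ _).trans (add_le_add ((norm_add_le _ _).trans
        (add_le_add (norm_sub_le _ _) ?_)) ?_) <;> simp
    have h4 : ‖(1 / 4 : ℂ)‖ = 1 / 4 := by norm_num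
    rw [h4]
    have := ht (φ (projTC (w + v))) (φ (projTC (w - v))) (φ (projTC (w + Complex.I • v)))
      (φ (projTC (w - Complex.I • v)))
    have e : C * (‖w‖ ^ 2 + ‖v‖ ^ 2) = 1 / 4 * (C * ‖w + v‖ ^ 2 + C * ‖w - v‖ ^ 2
        + C * ‖w + Complex.I • v‖ ^ 2 + C * ‖w - Complex.I • v‖ ^ 2) := by
      linear_combination (-C / 4) * p1 + (-C / 4) * p2
    rw [e]
    gcongr
    exact this.trans (by gcongr <;> exact hb _)
  rcases eq_or_ne w 0 with rfl | hw
  · have : rankOneTC 0 v = 0 := Subtype.ext (by simp [rankOneTC])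
    simp [this]
  rcases eq_or_ne v 0 with rfl | hv
  · have : rankOneTC w 0 = 0 := Subtype.ext (by simp [rankOneTC])
    simp [this]
  have hw' := norm_ne_zero_iff.mpr hw
  have hv' := norm_ne_zero_iff.mpr hv
  have key : rankOneTC w v = ((‖v‖ * ‖w‖ : ℝ) : ℂ) •
      rankOneTC (((‖w‖⁻¹ : ℝ) : ℂ) • w) (((‖v‖⁻¹ : ℝ) : ℂ) • v) := by
    refine Subtype.ext ?_
    simp only [rankOneTC, Submodule.coe_smul, map_smul, map_smulₛₗ, smul_apply, Complex.conj_ofReal,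
      smul_smul, ← Complex.ofReal_mul]
    rw [show ‖v‖ * ‖w‖ * (‖v‖⁻¹ * ‖w‖⁻¹) = 1 by field_simp]
    simp
  have h1 := hsq (((‖w‖⁻¹ : ℝ) : ℂ) • w) (((‖v‖⁻¹ : ℝ) : ℂ) • v)
  rw [key, map_smul, norm_smul, Complex.norm_real, Real.norm_of_nonneg (by positivity)]
  simp only [norm_smul, Complex.norm_real, norm_inv, norm_norm, inv_mul_cancel₀ hw',
    inv_mul_cancel₀ hv'] at h1
  have := mul_le_mul_of_nonneg_left h1 (show 0 ≤ ‖v‖ * ‖w‖ by positivity)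
  linarith

lemma trace_proj_mul (ψ : Fock) (A : Op) : trace (proj ψ * A) = inner ℂ ψ (A ψ) := by
  have h := hasSum_inner_mul_inner_ket (ContinuousLinearMap.adjoint A ψ) ψ
  rw [ContinuousLinearMap.adjoint_inner_left] at h
  rw [← h.tsum_eq, trace]
  refine tsum_congr fun n => ?_
  rw [mul_apply_eq_comp, proj, InnerProductSpace.rankOne_apply, inner_smul_right,
    ContinuousLinearMap.adjoint_inner_left]

/-- Every positive functional on the trace class has the form `T ↦ Tr[T A]` on positive operators,
with `A` a bounded operator. -/
lemma exists_trace_representation (hφ : ∀ T : traceClass, (T : Op).IsPositive → 0 ≤ φ T) :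
    ∃ A : Op, ∀ T : traceClass, IsPositiveTraceClass (T : Op) → φ T = trace ((T : Op) * A) := by
  obtain ⟨C, -, hC⟩ := exists_bound_of_positive hφ
  let B : Fock →L⋆[ℂ] Fock →L[ℂ] ℂ := LinearMap.mkContinuous₂
    (LinearMap.mk₂'ₛₗ (starRingEnd ℂ) (RingHom.id ℂ) (fun v w => φ (rankOneTC w v))
      (fun v v' w => by
        rw [← map_add]; congr 1; exact Subtype.ext (by simp [rankOneTC]))
      (fun c v w => by
        rw [← map_smul]; congr 1; exact Subtype.ext (by simp [rankOneTC]))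
      (fun v w w' => by
        rw [← map_add]; congr 1; exact Subtype.ext (by simp [rankOneTC]))
      (fun c v w => by
        rw [RingHom.id_apply, ← map_smul]; congr 1; exact Subtype.ext (by simp [rankOneTC])))
    (2 * C) fun v w => norm_map_rankOneTC_le hφ hC w v
  let A : Op := ContinuousLinearMap.adjoint (InnerProductSpace.continuousLinearMapOfBilin B)
  have hA : ∀ ψ, φ (projTC ψ) = inner ℂ ψ (A ψ) := by
    intro ψ
    rw [ContinuousLinearMap.adjoint_inner_right,
      InnerProductSpace.continuousLinearMapOfBilin_apply]
    rfl
  refine ⟨A, fun T hT => ?_⟩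
  obtain ⟨s, hs, -, hsum, hsT⟩ := hT.exists_sqrt
  have hlim1 := (hasSum_inner_mul_self hs hsum A).tendsto_sum_nat
  rw [hsT] at hlim1
  refine tendsto_nhds_unique (f := fun N : ℕ => ∑ n ∈ Finset.range N, φ (projTC (s (ket n))))
    (l := Filter.atTop) ?_ (by simpa only [hA] using hlim1)
  rw [tendsto_iff_norm_sub_tendsto_zero]
  have hlim2 : Filter.Tendsto (fun N : ℕ => C * (∑' k, ‖s (ket k)‖ ^ 2
      - ∑ n ∈ Finset.range N, ‖s (ket n)‖ ^ 2)) Filter.atTop (nhds 0) := by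
    have := (hsum.hasSum.tendsto_sum_nat.const_sub (∑' k, ‖s (ket k)‖ ^ 2)).const_mul C
    rwa [sub_self, mul_zero] at this
  refine squeeze_zero (fun _ => norm_nonneg _) (fun N => ?_) hlim2
  obtain ⟨hp, ht⟩ := isPositiveTraceClass_remainder hs hsum N
  have hcoe : ((T - ∑ n ∈ Finset.range N, projTC (s (ket n)) : traceClass) : Op)
      = s * s - ∑ n ∈ Finset.range N, proj (s (ket n)) := by
    rw [Submodule.coe_sub, Submodule.coe_sum, hsT]; rfl
  rw [← hcoe] at hp ht
  have h1 := hφ _ hp.1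
  have h2 := hC _ hp
  rw [ht] at h2
  rwa [norm_sub_rev, ← map_sum, ← map_sub, ← Complex.re_eq_norm.mpr h1]

/-! ### Completely positive maps on mixtures of pure states -/

section HullIntegral

open MeasureTheory

variable {μ : Measure Fock} {ρ : traceClass}

/-- The integral cannot be zero by the convention for non-integrable functions, since a state has
trace one. -/
lemma integrable_proj_of_isState (hρ : IsState (ρ : Op)) (h : (ρ : Op) = ∫ ψ, proj ψ ∂μ) :
    Integrable proj μ := by
  by_contra hint
  rw [integral_undef hint] at h
  have := hρ.hasSum_diagEntry
  rw [h, show diagEntry 0 = fun _ => 0 from funext fun n => by simp [diagEntry]] at this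
  exact zero_ne_one (hasSum_zero.unique this)

lemma inner_mixture_apply (hρ : IsState (ρ : Op)) (h : (ρ : Op) = ∫ ψ, proj ψ ∂μ) (x y : Fock) :
    inner ℂ x ((ρ : Op) y) = ∫ ψ, (inner ℂ ψ y * inner ℂ x ψ : ℂ) ∂μ := by
  have := ((innerSL ℂ x).comp (ContinuousLinearMap.apply ℂ Fock y)).integral_comp_comm
    (integrable_proj_of_isState hρ h)
  rw [← h] at this
  rw [show inner ℂ x ((ρ : Op) y) = _ from this.symm]
  refine integral_congr_ae (Filter.Eventually.of_forall fun ψ => ?_)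
  simp [proj]

/-- A positive functional on the trace class commutes with the integral that defines a mixture of
pure states, although that integral converges only in the operator norm. -/
lemma map_mixture_eq_integral [IsProbabilityMeasure μ] {φ : traceClass →ₗ[ℂ] ℂ}
    (hφ : ∀ T : traceClass, (T : Op).IsPositive → 0 ≤ φ T) (hρ : IsState (ρ : Op))
    (hμ : ∀ᵐ ψ ∂μ, ‖ψ‖ = 1) (h : (ρ : Op) = ∫ ψ, proj ψ ∂μ) :
    Integrable (fun ψ => φ (projTC ψ)) μ ∧ φ ρ = ∫ ψ, φ (projTC ψ) ∂μ := by
  obtain ⟨A, hA⟩ := exists_trace_representation hφ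
  have hAψ : ∀ ψ, φ (projTC ψ) = inner ℂ ψ (A ψ) := fun ψ =>
    (hA _ (isPositiveTraceClass_proj ψ)).trans (trace_proj_mul ψ A)
  simp only [hAψ, hA ρ hρ.isPositiveTraceClass]
  have hbd : Integrable (fun ψ : Fock =>
      (‖ContinuousLinearMap.adjoint A ψ‖ ^ 2 + ‖ψ‖ ^ 2) / 2) μ := by
    refine Integrable.of_bound (Continuous.aestronglyMeasurable (by fun_prop))
      ((‖A‖ ^ 2 + 1) / 2) ?_
    filter_upwards [hμ] with ψ hψ
    rw [Real.norm_of_nonneg (by positivity)]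
    have := norm_adjoint_apply_sq_le (B := A) le_rfl ψ
    rw [hψ] at this ⊢
    linarith
  have hs : ∀ ψ : Fock, HasSum (fun n => (‖(inner ℂ ψ (A (ket n)) : ℂ)‖ ^ 2
      + ‖(inner ℂ (ket n) ψ : ℂ)‖ ^ 2) / 2)
      ((‖ContinuousLinearMap.adjoint A ψ‖ ^ 2 + ‖ψ‖ ^ 2) / 2) := fun ψ => by
    simp only [norm_inner_map_ket A]
    exact ((hasSum_norm_sq_inner_ket _).add (hasSum_norm_sq_inner_ket _)).div_const 2
  constructor
  · refine Integrable.of_bound (Continuous.aestronglyMeasurable (by fun_prop)) ‖A‖ ?_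
    filter_upwards [hμ] with ψ hψ
    refine (norm_inner_le_norm _ _).trans ?_
    simpa [hψ] using A.le_opNorm ψ
  · have hsum := hasSum_integral_of_dominated_convergence (μ := μ)
      (F := fun n ψ => (inner ℂ ψ (A (ket n)) * inner ℂ (ket n) ψ : ℂ))
      (f := fun ψ => inner ℂ ψ (A ψ))
      (fun n ψ => (‖(inner ℂ ψ (A (ket n)) : ℂ)‖ ^ 2 + ‖(inner ℂ (ket n) ψ : ℂ)‖ ^ 2) / 2)
      (fun n => Continuous.aestronglyMeasurable (by fun_prop))
      (fun n => Filter.Eventually.of_forall fun ψ => norm_mul_le_half_add_sq _ _)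
      (Filter.Eventually.of_forall fun ψ => (hs ψ).summable)
      (by simpa only [(hs _).tsum_eq] using hbd)
      (Filter.Eventually.of_forall fun ψ => by
        simpa only [ContinuousLinearMap.adjoint_inner_left] using
          hasSum_inner_mul_inner_ket (ContinuousLinearMap.adjoint A ψ) ψ)
    rw [← hsum.tsum_eq, trace]
    exact tsum_congr fun n => inner_mixture_apply hρ h (ket n) (A (ket n))

lemma inner_apply_polarization (T : Op) (x y : Fock) :
    inner ℂ x (T y) = (1 / 4 : ℂ) * (inner ℂ (x + y) (T (x + y)) - inner ℂ (x - y) (T (x - y))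
      - Complex.I * inner ℂ (x + Complex.I • y) (T (x + Complex.I • y))
      + Complex.I * inner ℂ (x - Complex.I • y) (T (x - Complex.I • y))) := by
  simp only [map_add, map_sub, map_smul, inner_add_left, inner_add_right, inner_sub_left,
    inner_sub_right, inner_smul_left, inner_smul_right, Complex.conj_I]
  ring_nf
  simp only [Complex.I_sq]
  ring

lemma IsCompletelyPositive.map_isPositive {E : traceClass →ₗ[ℂ] traceClass}
    (hE : IsCompletelyPositive E) {T : traceClass} (hT : (T : Op).IsPositive) :
    (E T : Op).IsPositive := by
  refine isPositive_of_inner_nonneg fun x => ?_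
  simpa using hE 1 (fun _ _ => T) (fun v => by simpa using hT.inner_nonneg_right (v 0))
    (fun _ => x)

/-- The functional `T ↦ ⟨x|E(T)|y⟩`. -/
def matrixElement (E : traceClass →ₗ[ℂ] traceClass) (x y : Fock) : traceClass →ₗ[ℂ] ℂ where
  toFun T := inner ℂ x ((E T : Op) y)
  map_add' S T := by simp
  map_smul' c T := by simp

/-- A completely positive map acts entrywise under the integral that defines a mixture of pure
states. -/
lemma IsCompletelyPositive.inner_map_mixture [IsProbabilityMeasure μ]
    {E : traceClass →ₗ[ℂ] traceClass}
    (hE : IsCompletelyPositive E) (hρ : IsState (ρ : Op)) (hμ : ∀ᵐ ψ ∂μ, ‖ψ‖ = 1)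
    (h : (ρ : Op) = ∫ ψ, proj ψ ∂μ) (x y : Fock) :
    Integrable (fun ψ => (inner ℂ x ((E (projTC ψ) : Op) y) : ℂ)) μ ∧
      inner ℂ x ((E ρ : Op) y) = ∫ ψ, (inner ℂ x ((E (projTC ψ) : Op) y) : ℂ) ∂μ := by
  have hd := fun z => map_mixture_eq_integral (φ := matrixElement E z z)
    (fun T hT => (hE.map_isPositive hT).inner_nonneg_right z) hρ hμ h
  have hi := fun z => (hd z).1
  have he := fun z => (hd z).2
  simp only [matrixElement, LinearMap.coe_mk, AddHom.coe_mk] at hi he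
  simp only [inner_apply_polarization _ x y]
  refine ⟨(((((hi _).sub (hi _)).sub ((hi _).const_mul _)).add ((hi _).const_mul _)).const_mul _),
    ?_⟩
  have key : ∀ f₁ f₂ f₃ f₄ : Fock → ℂ, Integrable f₁ μ → Integrable f₂ μ → Integrable f₃ μ →
      Integrable f₄ μ → ∫ ψ, (f₁ ψ - f₂ ψ - Complex.I * f₃ ψ + Complex.I * f₄ ψ) ∂μ
        = ∫ ψ, f₁ ψ ∂μ - ∫ ψ, f₂ ψ ∂μ - Complex.I * ∫ ψ, f₃ ψ ∂μ + Complex.I * ∫ ψ, f₄ ψ ∂μ := by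
    intro f₁ f₂ f₃ f₄ h₁ h₂ h₃ h₄
    have h₁₂ : Integrable (fun ψ => f₁ ψ - f₂ ψ) μ := h₁.sub h₂
    have h₁₂₃ : Integrable (fun ψ => f₁ ψ - f₂ ψ - Complex.I * f₃ ψ) μ := h₁₂.sub (h₃.const_mul _)
    rw [integral_add h₁₂₃ (h₄.const_mul _), integral_sub h₁₂ (h₃.const_mul _),
      integral_sub h₁ h₂, integral_const_mul, integral_const_mul]
  rw [integral_const_mul, key _ _ _ _ (hi _) (hi _) (hi _) (hi _)]
  simp only [he]

end HullIntegral

/-! ### The Weyl relation for the displacement operators -/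

section CauchyProduct

open Finset

variable {R : Type*} [Ring R]

/-- The Cauchy product of two sequences in a ring that need not be commutative. -/
def cauchyProd (f g : ℕ → R) (N : ℕ) : R := ∑ p ∈ antidiagonal N, f p.1 * g p.2

/-- The coefficients of the formal derivative of a power series. -/
def coeffDeriv (f : ℕ → R) (n : ℕ) : R := (n + 1) • f (n + 1)

/-- The coefficients of `X` times a power series. -/
def coeffShift (f : ℕ → R) : ℕ → R
  | 0 => 0
  | n + 1 => f n

lemma coeffDeriv_cauchyProd (f g : ℕ → R) (N : ℕ) :
    coeffDeriv (cauchyProd f g) N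
      = cauchyProd (coeffDeriv f) g N + cauchyProd f (coeffDeriv g) N := by
  have h1 : coeffDeriv (cauchyProd f g) N
      = ∑ p ∈ antidiagonal (N + 1), p.1 • f p.1 * g p.2
        + ∑ p ∈ antidiagonal (N + 1), f p.1 * p.2 • g p.2 := by
    rw [coeffDeriv, cauchyProd, smul_sum, ← sum_add_distrib]
    refine sum_congr rfl fun p hp => ?_
    rw [HasAntidiagonal.mem_antidiagonal] at hp
    rw [← hp, add_smul, smul_mul_assoc, mul_smul_comm]
  rw [h1, Nat.sum_antidiagonal_succ, Nat.sum_antidiagonal_succ']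
  simp [cauchyProd, coeffDeriv]

lemma cauchyProd_coeffShift (f g : ℕ → R) (N : ℕ) :
    cauchyProd (coeffShift f) g N = coeffShift (cauchyProd f g) N := by
  cases N with
  | zero => simp [cauchyProd, coeffShift]
  | succ N => simp [cauchyProd, coeffShift, Nat.sum_antidiagonal_succ]

variable [Algebra ℂ R]

/-- The coefficients of the exponential series of an element. -/
def expCoeff (A : R) (n : ℕ) : R := ((n.factorial : ℂ)⁻¹) • A ^ n

lemma coeffDeriv_expCoeff (A : R) (n : ℕ) : coeffDeriv (expCoeff A) n = A * expCoeff A n := by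
  have h : (n.factorial : ℂ) ≠ 0 := by exact_mod_cast n.factorial_ne_zero
  have h' : (n : ℂ) + 1 ≠ 0 := by exact_mod_cast n.succ_ne_zero
  rw [coeffDeriv, expCoeff, expCoeff, ← Nat.cast_smul_eq_nsmul ℂ, smul_smul, mul_smul_comm,
    ← pow_succ', Nat.factorial_succ]
  congr 1
  push_cast
  field_simp

/-- The coefficients of `exp (c t² / 2)`. -/
def gaussCoeff (c : ℂ) (n : ℕ) : ℂ :=
  if Even n then (c / 2) ^ (n / 2) / (n / 2).factorial else 0

lemma coeffDeriv_gaussCoeff (c : ℂ) (n : ℕ) :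
    coeffDeriv (gaussCoeff c) n = c * coeffShift (gaussCoeff c) n := by
  cases n with
  | zero => simp [coeffDeriv, coeffShift, gaussCoeff]
  | succ n =>
    rw [coeffDeriv, coeffShift, gaussCoeff, gaussCoeff]
    by_cases h : Even n
    · obtain ⟨k, rfl⟩ := h
      have e1 : (k + k + 1 + 1) / 2 = k + 1 := by omega
      have e2 : (k + k) / 2 = k := by omega
      have e3 : Even (k + k + 1 + 1) := ⟨k + 1, by ring⟩
      have h1 : (k.factorial : ℂ) ≠ 0 := by exact_mod_cast k.factorial_ne_zero
      have h2 : (k : ℂ) + 1 ≠ 0 := by exact_mod_cast k.succ_ne_zero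
      rw [e1, e2, if_pos e3, if_pos ⟨k, rfl⟩, Nat.factorial_succ, nsmul_eq_mul]
      push_cast
      field_simp
      ring
    · have h' : ¬ Even (n + 1 + 1) := by
        rwa [Nat.even_add_one, Nat.even_add_one, not_not]
      rw [if_neg h, if_neg h']; simp

lemma hasSum_gaussCoeff (c : ℂ) : HasSum (gaussCoeff c) (Complex.exp (c / 2)) := by
  have hinj : Function.Injective fun i : ℕ => 2 * i := fun a b h => by simpa using h
  rw [← hinj.hasSum_iff]
  · have h := NormedSpace.expSeries_div_hasSum_exp (c / 2)
    rw [← Complex.exp_eq_exp_ℂ] at h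
    refine h.congr_fun fun i => ?_
    simp [gaussCoeff]
  · intro n hn
    refine if_neg fun ⟨k, hk⟩ => hn ⟨k, by simp only; omega⟩

lemma expCoeff_mul_eq {A B : R} {c : ℂ} (h : A * B = B * A + algebraMap ℂ R c) (n : ℕ) :
    expCoeff A n * B = B * expCoeff A n + c • coeffShift (expCoeff A) n := by
  have hpow : ∀ n : ℕ, A ^ (n + 1) * B = B * A ^ (n + 1) + (n + 1) • c • A ^ n := by
    intro n
    induction n with
    | zero => simp [h, Algebra.algebraMap_eq_smul_one]
    | succ n ih =>
      rw [pow_succ', mul_assoc, ih, mul_add, ← mul_assoc, h, add_mul, mul_assoc, ← pow_succ',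
        ← Algebra.smul_def, mul_smul_comm, mul_smul_comm, ← pow_succ', add_assoc,
        add_smul (n + 1) 1, one_smul, add_comm (c • A ^ (n + 1))]
  cases n with
  | zero => simp [expCoeff, coeffShift]
  | succ n =>
    have h1 : (n.factorial : ℂ) ≠ 0 := by exact_mod_cast n.factorial_ne_zero
    have h2 : (n : ℂ) + 1 ≠ 0 := by exact_mod_cast n.succ_ne_zero
    rw [expCoeff, smul_mul_assoc, hpow, smul_add, mul_smul_comm, coeffShift, expCoeff,
      ← Nat.cast_smul_eq_nsmul ℂ, smul_smul, smul_smul, smul_smul]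
    congr 2
    rw [Nat.factorial_succ]
    push_cast
    field_simp

/-- The identity `exp (tA) exp (tB) = exp (t²c/2) exp (t(A+B))` of formal power series in `t`, when
the commutator of `A` and `B` is the scalar `c`. -/
lemma cauchyProd_expCoeff {A B : R} {c : ℂ} (h : A * B = B * A + algebraMap ℂ R c) (N : ℕ) :
    cauchyProd (expCoeff A) (expCoeff B) N
      = ∑ p ∈ antidiagonal N, gaussCoeff c p.1 • expCoeff (A + B) p.2 := by
  set P := cauchyProd (expCoeff A) (expCoeff B) with hP
  set g : ℕ → R := fun n => algebraMap ℂ R (gaussCoeff c n) with hg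
  set Q := cauchyProd g (expCoeff (A + B)) with hQ
  have hPd : ∀ n, coeffDeriv P n = (A + B) * P n + c • coeffShift P n := by
    intro n
    rw [hP, coeffDeriv_cauchyProd, ← cauchyProd_coeffShift]
    simp only [cauchyProd, mul_sum, smul_sum, ← sum_add_distrib]
    refine sum_congr rfl fun p _ => ?_
    rw [coeffDeriv_expCoeff, coeffDeriv_expCoeff, ← mul_assoc (expCoeff A p.1),
      expCoeff_mul_eq h, add_mul _ (c • _), smul_mul_assoc]
    noncomm_ring
  have hgd : coeffDeriv g = fun n => c • coeffShift g n := by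
    funext n
    have h1 := congrArg (algebraMap ℂ R) (coeffDeriv_gaussCoeff c n)
    rw [coeffDeriv, map_nsmul, map_mul] at h1
    rw [coeffDeriv, h1, ← Algebra.smul_def]
    cases n <;> simp [coeffShift, hg]
  have hQd : ∀ n, coeffDeriv Q n = (A + B) * Q n + c • coeffShift Q n := by
    intro n
    rw [hQ, coeffDeriv_cauchyProd, ← cauchyProd_coeffShift, hgd]
    simp only [cauchyProd, mul_sum, smul_sum, ← sum_add_distrib]
    refine sum_congr rfl fun p _ => ?_
    rw [coeffDeriv_expCoeff, ← mul_assoc (g p.1), Algebra.commutes, smul_mul_assoc, mul_assoc,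
      add_comm]
  have hPQ : ∀ n, P n = Q n := by
    intro n
    induction n using Nat.strong_induction_on with
    | _ n ih =>
      cases n with
      | zero => simp [hP, hQ, cauchyProd, expCoeff, hg, gaussCoeff]
      | succ n =>
        have h1 : coeffDeriv P n = coeffDeriv Q n := by
          rw [hPd, hQd, ih n (by omega)]
          cases n with
          | zero => rfl
          | succ n => rw [coeffShift, coeffShift, ih n (by omega)]
        rw [coeffDeriv, coeffDeriv, ← Nat.cast_smul_eq_nsmul ℂ, ← Nat.cast_smul_eq_nsmul ℂ] at h1
        exact smul_right_injective R (r := ((n + 1 : ℕ) : ℂ))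
          (by exact_mod_cast n.succ_ne_zero) h1
  rw [hPQ, hQ, cauchyProd]
  simp only [hg, ← Algebra.smul_def]

end CauchyProduct

lemma creation_annihilation_fket (n : ℕ) :
    creation (annihilation (fket n)) = (n : ℂ) • fket n := by
  rw [annihilation_fket, map_smul, creation_fket, smul_smul, ← Complex.ofReal_mul]
  rcases n with _ | n
  · simp
  · rw [Nat.add_sub_cancel, Nat.cast_add_one, Real.mul_self_sqrt (by positivity)]
    simp

lemma annihilation_creation_fket (n : ℕ) :
    annihilation (creation (fket n)) = ((n : ℂ) + 1) • fket n := by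
  rw [creation_fket, map_smul, annihilation_fket, smul_smul, ← Complex.ofReal_mul,
    Nat.add_sub_cancel, Nat.cast_add_one, Real.mul_self_sqrt (by positivity)]
  simp

lemma annihilation_creation (x : FinVec) :
    annihilation (creation x) = creation (annihilation x) + x := by
  induction x using finVec_induction with
  | h0 => simp
  | hadd x y hx hy => simp only [map_add, hx, hy]; abel
  | hs c n =>
    simp only [map_smul, annihilation_creation_fket, creation_annihilation_fket]
    module

lemma displacementExponent_mul (γ δ : ℂ) :
    displacementExponent γ * displacementExponent δ
      = displacementExponent δ * displacementExponent γ
        + algebraMap ℂ (Module.End ℂ FinVec) (γ * conj δ - conj γ * δ) := by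
  refine LinearMap.ext fun x => ?_
  simp only [displacementExponent, Module.End.mul_apply, LinearMap.sub_apply, LinearMap.smul_apply,
    map_sub, map_smul, LinearMap.add_apply, Module.algebraMap_end_apply, annihilation_creation]
  module

lemma displacementExponent_add (γ δ : ℂ) :
    displacementExponent (γ + δ) = displacementExponent γ + displacementExponent δ := by
  simp only [displacementExponent, map_add]
  module

lemma displacementExponent_real_smul (t : ℝ) (γ : ℂ) :
    displacementExponent (t * γ) = (t : ℂ) • displacementExponent γ := by
  simp only [displacementExponent, map_mul, Complex.conj_ofReal]
  module

lemma displacementExponent_neg (γ : ℂ) :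
    displacementExponent (-γ) = (-1 : ℂ) • displacementExponent γ := by
  simp only [displacementExponent, map_neg]
  module

lemma displacementTerm_eq (γ : ℂ) (n k : ℕ) :
    displacementTerm γ n k = incl (expCoeff (displacementExponent γ) k (fket n)) := by
  simp [displacementTerm, expCoeff]

/-- The Weyl relation between the matrix elements of the displacement operators. -/
lemma inner_displacedKet_neg (γ δ : ℂ) (m n : ℕ) :
    (inner ℂ (displacedKet (-γ) m) (displacedKet δ n) : ℂ)
      = Complex.exp ((γ * conj δ - conj γ * δ) / 2) *
        inner ℂ (ket m) (displacedKet (γ + δ) n) := by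
  have hF : Summable fun p : ℕ × ℕ =>
      (inner ℂ (displacementTerm (-γ) m p.1) (displacementTerm δ n p.2) : ℂ) := by
    refine Summable.of_norm_bounded
      ((summable_norm_displacementTerm (-γ) m).mul_of_nonneg (summable_norm_displacementTerm δ n)
        (fun _ => norm_nonneg _) (fun _ => norm_nonneg _)) fun p => norm_inner_le_norm _ _
  have hrow : ∀ j, HasSum
      (fun k => (inner ℂ (displacementTerm (-γ) m j) (displacementTerm δ n k) : ℂ))
      (inner ℂ (displacementTerm (-γ) m j) (displacedKet δ n)) := fun j =>
    (hasSum_displacedKet δ n).mapL (innerSL ℂ (displacementTerm (-γ) m j))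
  have hcol : HasSum (fun j => (inner ℂ (displacementTerm (-γ) m j) (displacedKet δ n) : ℂ))
      (inner ℂ (displacedKet (-γ) m) (displacedKet δ n)) := by
    have h := ((hasSum_displacedKet (-γ) m).mapL (innerSL ℂ (displacedKet δ n))).map
      (starRingEnd ℂ) Complex.continuous_conj
    simpa [Function.comp_def, inner_conj_symm] using h
  have h1 := (hF.hasSum.prod_fiberwise hrow).unique hcol
  have hG := (Finset.HasAntidiagonal.sigmaAntidiagonalEquivProd.hasSum_iff.mpr hF.hasSum).sigma
    (fun N => hasSum_fintype _)
  rw [h1] at hG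
  have hterm : ∀ N : ℕ, ∑ p ∈ Finset.HasAntidiagonal.antidiagonal N,
      (inner ℂ (displacementTerm (-γ) m p.1) (displacementTerm δ n p.2) : ℂ)
      = ∑ p ∈ Finset.HasAntidiagonal.antidiagonal N, gaussCoeff (γ * conj δ - conj γ * δ) p.1
        * inner ℂ (ket m) (displacementTerm (γ + δ) n p.2) := by
    intro N
    have h2 := congrArg (fun T : Module.End ℂ FinVec => (inner ℂ (ket m) (incl (T (fket n))) : ℂ))
      (cauchyProd_expCoeff (displacementExponent_mul γ δ) N)
    simp only [cauchyProd, LinearMap.sum_apply, map_sum, inner_sum, LinearMap.smul_apply, map_smul,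
      inner_smul_right, ← displacementExponent_add, ← displacementTerm_eq] at h2
    rw [← h2]
    refine Finset.sum_congr rfl fun p _ => ?_
    rw [displacementTerm, displacementExponent_neg, smul_pow, LinearMap.smul_apply, map_smul,
      inner_smul_left, inner_smul_left, displacementTerm_eq δ, displacementExponent_pow_skew]
    simp only [expCoeff, Module.End.mul_apply, LinearMap.smul_apply, map_smul, inner_smul_right,
      incl_fket, map_inv₀,
      Complex.conj_natCast, map_pow, map_neg, map_one]
    have : ((-1 : ℂ) ^ p.1) * (-1) ^ p.1 = 1 := by rw [← mul_pow]; simp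
    linear_combination ((p.1.factorial : ℂ)⁻¹ * (p.2.factorial : ℂ)⁻¹ * inner ℂ (ket m)
      (incl ((displacementExponent γ ^ p.1) ((displacementExponent δ ^ p.2) (fket n))))) * this
  have hv : HasSum (fun k => (inner ℂ (ket m) (displacementTerm (γ + δ) n k) : ℂ))
      (inner ℂ (ket m) (displacedKet (γ + δ) n)) :=
    (hasSum_displacedKet (γ + δ) n).mapL (innerSL ℂ (ket m))
  have hprod := tsum_mul_tsum_eq_tsum_sum_antidiagonal_of_summable_norm
    (hasSum_gaussCoeff (γ * conj δ - conj γ * δ)).summable.norm hv.summable.norm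
  rw [(hasSum_gaussCoeff _).tsum_eq, hv.tsum_eq] at hprod
  rw [hprod, ← hG.tsum_eq]
  refine tsum_congr fun N => ?_
  rw [← hterm N, ← Finset.sum_coe_sort (Finset.HasAntidiagonal.antidiagonal N)]
  rfl

lemma hasSum_smul_ket (x : Fock) : HasSum (fun n => x n • ket n) x := by
  refine (lp.hasSum_single (by norm_num) x).congr_fun fun n => ?_
  rw [ket, ← lp.single_smul, smul_eq_mul, mul_one]

/-- Bounded operators with the same matrix elements in the number basis are equal. -/
lemma op_ext {S T : Op}
    (h : ∀ m n, (inner ℂ (ket m) (S (ket n)) : ℂ) = inner ℂ (ket m) (T (ket n))) :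
    S = T := by
  have hk : ∀ n, S (ket n) = T (ket n) := fun n => lp.ext (funext fun m => by
    simpa only [inner_ket_left] using h m n)
  refine ContinuousLinearMap.ext fun x => ?_
  refine ((hasSum_smul_ket x).mapL S).unique ?_
  simpa only [map_smul, hk] using (hasSum_smul_ket x).mapL T

lemma norm_displacement_apply (γ : ℂ) (x : Fock) : ‖displacement γ x‖ = ‖x‖ :=
  (orthonormal_displacedKet γ).orthogonalFamily.linearIsometry.norm_map x

lemma norm_displacement_le (γ : ℂ) : ‖displacement γ‖ ≤ 1 :=
  ContinuousLinearMap.opNorm_le_bound _ zero_le_one fun x => by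
    rw [norm_displacement_apply, one_mul]

/-- The Weyl relation, with `D(-γ)†` in place of `D(γ)`. -/
lemma adjoint_displacement_neg_mul (γ δ : ℂ) :
    ContinuousLinearMap.adjoint (displacement (-γ)) * displacement δ
      = Complex.exp ((γ * conj δ - conj γ * δ) / 2) • displacement (γ + δ) := by
  refine op_ext fun m n => ?_
  rw [mul_apply_eq_comp, ContinuousLinearMap.adjoint_inner_right, displacement_ket,
    displacement_ket, inner_displacedKet_neg, smul_apply, inner_smul_right, displacement_ket]

lemma displacementTerm_real_mul (t : ℝ) (γ : ℂ) (n k : ℕ) :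
    displacementTerm (t * γ) n k = (t : ℂ) ^ k • displacementTerm γ n k := by
  rw [displacementTerm, displacementTerm, displacementExponent_real_smul, smul_pow,
    LinearMap.smul_apply, map_smul, smul_comm]

lemma displacement_zero : displacement 0 = 1 := by
  refine op_ext fun m n => ?_
  rw [displacement_ket, displacedKet, tsum_eq_single 0]
  · simp [displacementTerm, incl_fket]
  · intro k hk
    simpa [hk] using displacementTerm_real_mul 0 0 n k

lemma adjoint_displacement_neg (γ : ℂ) :
    ContinuousLinearMap.adjoint (displacement (-γ)) = displacement γ := by
  simpa [displacement_zero] using adjoint_displacement_neg_mul γ 0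

lemma displacement_mul (γ δ : ℂ) :
    displacement γ * displacement δ
      = Complex.exp ((γ * conj δ - conj γ * δ) / 2) • displacement (γ + δ) := by
  rw [← adjoint_displacement_neg γ, adjoint_displacement_neg_mul]

lemma adjoint_displacement_mul (γ δ : ℂ) :
    ContinuousLinearMap.adjoint (displacement γ) * displacement δ
      = Complex.exp ((conj γ * δ - γ * conj δ) / 2) • displacement (δ - γ) := by
  have h := adjoint_displacement_neg_mul (-γ) δ
  rw [neg_neg] at h
  rw [h, neg_add_eq_sub, map_neg]
  congr 3
  ring

lemma displacement_natCast_mul_succ (β : ℂ) (k : ℕ) :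
    displacement (((k + 1 : ℕ) : ℂ) * β) = displacement β * displacement (k * β) := by
  rw [displacement_mul, map_mul, Complex.conj_natCast]
  rw [show (β * (k * conj β) - conj β * (k * β)) / 2 = 0 by ring, Complex.exp_zero, one_smul]
  congr 1
  push_cast
  ring

lemma norm_displacement_natCast_mul_sub_le (β : ℂ) (x : Fock) (k : ℕ) :
    ‖displacement (k * β) x - x‖ ≤ k * ‖displacement β x - x‖ := by
  induction k with
  | zero => simp [displacement_zero]
  | succ k ih =>
    have h : displacement (((k + 1 : ℕ) : ℂ) * β) x - x
        = displacement β (displacement (k * β) x - x) + (displacement β x - x) := by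
      rw [displacement_natCast_mul_succ, mul_apply_eq_comp, map_sub]; abel
    rw [h]
    refine (norm_add_le _ _).trans ?_
    rw [norm_displacement_apply]
    push_cast
    linarith

lemma norm_displacement_real_mul_ket_sub_le {t : ℝ} (h0 : 0 ≤ t) (h1 : t ≤ 1) (γ : ℂ) (n : ℕ) :
    ‖displacement (t * γ) (ket n) - ket n - (t : ℂ) • incl (displacementExponent γ (fket n))‖
      ≤ t ^ 2 * ∑' k, ‖displacementTerm γ n k‖ := by
  have hs := hasSum_displacedKet (t * γ) n
  have hn := summable_norm_displacementTerm γ n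
  rw [← hasSum_nat_add_iff' 2] at hs
  have e : displacement (t * γ) (ket n) - ket n - (t : ℂ) • incl (displacementExponent γ (fket n))
      = displacedKet (t * γ) n - ∑ i ∈ Finset.range 2, displacementTerm (t * γ) n i := by
    rw [displacement_ket, Finset.sum_range_succ, Finset.sum_range_one, displacementTerm_real_mul,
      displacementTerm_real_mul]
    simp [displacementTerm, incl_fket, sub_sub]
  rw [e, ← hs.tsum_eq, ← tsum_mul_left]
  have hle : ∀ k, ‖displacementTerm (t * γ) n (k + 2)‖
      ≤ t ^ 2 * ‖displacementTerm γ n (k + 2)‖ := by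
    intro k
    rw [displacementTerm_real_mul, norm_smul, norm_pow, Complex.norm_real, Real.norm_of_nonneg h0]
    gcongr ?_ * _
    exact pow_le_pow_of_le_one h0 h1 (by omega)
  have hn2 : Summable fun k => t ^ 2 * ‖displacementTerm γ n (k + 2)‖ :=
    ((summable_nat_add_iff 2).mpr hn).mul_left _
  refine (tsum_of_norm_bounded hn2.hasSum hle).trans ?_
  rw [tsum_mul_left, tsum_mul_left]
  refine mul_le_mul_of_nonneg_left ?_ (by positivity)
  rw [← hn.sum_add_tsum_nat_add 2]
  exact le_add_of_nonneg_left (Finset.sum_nonneg fun _ _ => norm_nonneg _)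

/-- On finite vectors, `D(tγ)` agrees with `1 + t (γ a† - γ* a)` up to an error of order `t²`. -/
lemma exists_norm_displacement_sub_le (γ : ℂ) (x : FinVec) :
    ∃ C : ℝ, ∀ t : ℝ, 0 ≤ t → t ≤ 1 →
      ‖displacement (t * γ) (incl x) - incl x - (t : ℂ) • incl (displacementExponent γ x)‖
        ≤ t ^ 2 * C := by
  induction x using finVec_induction with
  | h0 => exact ⟨0, fun t _ _ => by simp⟩
  | hadd x y hx hy =>
    obtain ⟨C, hC⟩ := hx
    obtain ⟨C', hC'⟩ := hy
    refine ⟨C + C', fun t h0 h1 => ?_⟩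
    have e : displacement (t * γ) (incl (x + y)) - incl (x + y)
        - (t : ℂ) • incl (displacementExponent γ (x + y))
        = (displacement (t * γ) (incl x) - incl x - (t : ℂ) • incl (displacementExponent γ x))
        + (displacement (t * γ) (incl y) - incl y - (t : ℂ) • incl (displacementExponent γ y)) := by
      simp only [map_add, smul_add]; abel
    rw [e, mul_add]
    exact (norm_add_le _ _).trans (add_le_add (hC t h0 h1) (hC' t h0 h1))
  | hs c n =>
    refine ⟨‖c‖ * ∑' k, ‖displacementTerm γ n k‖, fun t h0 h1 => ?_⟩
    have e : displacement (t * γ) (incl (c • fket n)) - incl (c • fket n)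
        - (t : ℂ) • incl (displacementExponent γ (c • fket n))
        = c • (displacement (t * γ) (ket n) - ket n
          - (t : ℂ) • incl (displacementExponent γ (fket n))) := by
      simp only [map_smul, incl_fket, smul_sub, smul_comm (t : ℂ) c]
    rw [e, norm_smul]
    have := mul_le_mul_of_nonneg_left (norm_displacement_real_mul_ket_sub_le h0 h1 γ n)
      (norm_nonneg c)
    linarith

/-- The displacement moves a finite vector by at most the norm of its image under the exponent:
subdivide the path `t ↦ D(tγ)` into equal steps. -/
lemma norm_displacement_sub_le (γ : ℂ) (x : FinVec) :
    ‖displacement γ (incl x) - incl x‖ ≤ ‖incl (displacementExponent γ x)‖ := by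
  obtain ⟨C, hC⟩ := exists_norm_displacement_sub_le γ x
  have hlim : Filter.Tendsto
      (fun k : ℕ => ‖incl (displacementExponent γ x)‖ + C * (1 / ((k : ℝ) + 1)))
      Filter.atTop (nhds ‖incl (displacementExponent γ x)‖) := by
    simpa using ((tendsto_one_div_add_atTop_nhds_zero_nat (𝕜 := ℝ)).const_mul C).const_add
      ‖incl (displacementExponent γ x)‖
  refine ge_of_tendsto' hlim fun k => ?_
  have hk : (0 : ℝ) < (k : ℝ) + 1 := by positivity
  set t : ℝ := 1 / ((k : ℝ) + 1) with ht
  have ht0 : 0 ≤ t := by positivity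
  have ht1 : t ≤ 1 := by rw [ht, div_le_one hk]; linarith [Nat.cast_nonneg (α := ℝ) k]
  have hkt : ((k : ℝ) + 1) * t = 1 := by rw [ht]; field_simp
  have h1 := norm_displacement_natCast_mul_sub_le (t * γ) (incl x) (k + 1)
  rw [← mul_assoc, show ((k + 1 : ℕ) : ℂ) * (t : ℂ) = 1 by exact_mod_cast hkt, one_mul] at h1
  have h2 := norm_le_norm_add_norm_sub' (displacement (t * γ) (incl x) - incl x)
    ((t : ℂ) • incl (displacementExponent γ x))
  rw [norm_smul, Complex.norm_real, Real.norm_of_nonneg ht0] at h2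
  have h3 := h2.trans (add_le_add_right (hC t ht0 ht1) _)
  have h4 := h1.trans (mul_le_mul_of_nonneg_left h3 (Nat.cast_nonneg _))
  refine h4.trans (le_of_eq ?_)
  push_cast
  linear_combination (‖incl (displacementExponent γ x)‖ + t * C) * hkt

/-! ### Energy bounds -/

/-- The identity `‖a†x‖² + ‖ax‖² = ⟨x|2 a†a + 1|x⟩`. -/
lemma norm_sq_creation_add_annihilation (c : ℕ → ℂ) (N : ℕ) :
    ‖incl (creation (∑ k ∈ Finset.range N, c k • fket k))‖ ^ 2
      + ‖incl (annihilation (∑ k ∈ Finset.range N, c k • fket k))‖ ^ 2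
      = ∑ k ∈ Finset.range N, (2 * (k : ℝ) + 1) * ‖c k‖ ^ 2 := by
  set x := ∑ k ∈ Finset.range N, c k • fket k with hx
  have h1 : (inner ℂ (incl (creation x)) (incl (creation x)) : ℂ)
      = inner ℂ (incl (annihilation (creation x))) (incl x) := creation_adjoint _ _
  have h2 : (inner ℂ (incl (annihilation x)) (incl (annihilation x)) : ℂ)
      = inner ℂ (incl (creation (annihilation x))) (incl x) := by
    simpa only [inner_conj_symm] using (congrArg conj (creation_adjoint x (annihilation x))).symm
  have h3 : incl (annihilation (creation x)) + incl (creation (annihilation x))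
      = ∑ k ∈ Finset.range N, (c k * (2 * (k : ℂ) + 1)) • ket k := by
    rw [hx]
    simp only [map_sum, map_smul, annihilation_creation_fket, creation_annihilation_fket, incl_fket,
      ← Finset.sum_add_distrib]
    exact Finset.sum_congr rfl fun k _ => by module
  have h4 : ∀ k ∈ Finset.range N, (inner ℂ (ket k) (incl x) : ℂ) = c k := by
    intro k hk
    simp [hx, map_sum, incl_fket, inner_ket, Finset.mem_range.mp hk]
  have h5 : ((‖incl (creation x)‖ ^ 2 + ‖incl (annihilation x)‖ ^ 2 : ℝ) : ℂ)
      = ((∑ k ∈ Finset.range N, (2 * (k : ℝ) + 1) * ‖c k‖ ^ 2 : ℝ) : ℂ) := by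
    push_cast
    have e1 := inner_self_eq_norm_sq_to_K (𝕜 := ℂ) (incl (creation x))
    have e2 := inner_self_eq_norm_sq_to_K (𝕜 := ℂ) (incl (annihilation x))
    rw [h1] at e1
    rw [h2] at e2
    have e3 : (inner ℂ (incl (annihilation (creation x))) (incl x) : ℂ)
        + inner ℂ (incl (creation (annihilation x))) (incl x)
        = ∑ k ∈ Finset.range N, inner ℂ ((c k * (2 * (k : ℂ) + 1)) • ket k) (incl x) := by
      rw [← inner_add_left, h3, sum_inner]
    rw [e1, e2] at e3
    refine e3.trans (Finset.sum_congr rfl fun k hk => ?_)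
    rw [inner_smul_left, h4 k hk, ← Complex.conj_mul' (c k)]
    simp only [map_mul, map_add, map_one, map_ofNat, Complex.conj_natCast]
    ring
  exact_mod_cast h5

/-- The exponents for the two orthogonal directions `r` and `ir` are `r (a† - a)` and
`ir (a† + a)`, so the parallelogram law adds up their squared norms. -/
lemma norm_sq_displacement_sub_add_le_finVec (r : ℝ) (x : FinVec) :
    ‖displacement r (incl x) - incl x‖ ^ 2 + ‖displacement (r * Complex.I) (incl x) - incl x‖ ^ 2
      ≤ 2 * r ^ 2 * (‖incl (creation x)‖ ^ 2 + ‖incl (annihilation x)‖ ^ 2) := by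
  have h1 := norm_displacement_sub_le (r : ℂ) x
  have h2 := norm_displacement_sub_le (r * Complex.I) x
  have e1 : ‖incl (displacementExponent r x)‖
      = |r| * ‖incl (creation x) - incl (annihilation x)‖ := by
    rw [← Real.norm_eq_abs, ← Complex.norm_real, ← norm_smul]
    simp only [displacementExponent, LinearMap.sub_apply, LinearMap.smul_apply, map_sub, map_smul,
      Complex.conj_ofReal, smul_sub]
  have e2 : ‖incl (displacementExponent (r * Complex.I) x)‖
      = |r| * ‖incl (creation x) + incl (annihilation x)‖ := by
    have : ‖((r : ℂ) * Complex.I)‖ = |r| := by simp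
    rw [← this, ← norm_smul]
    simp only [displacementExponent, LinearMap.sub_apply, LinearMap.smul_apply, map_sub, map_smul,
      map_mul, Complex.conj_ofReal, Complex.conj_I]
    congr 1
    module
  rw [e1] at h1
  rw [e2] at h2
  have p := parallelogram_law_with_norm ℂ (incl (creation x)) (incl (annihilation x))
  have s1 := pow_le_pow_left₀ (norm_nonneg _) h1 2
  have s2 := pow_le_pow_left₀ (norm_nonneg _) h2 2
  rw [mul_pow, sq_abs] at s1 s2
  nlinarith [congrArg (fun z => r ^ 2 * z) p]

/-- The bound extends from finite vectors to all vectors of finite energy by truncation. -/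
lemma norm_sq_displacement_sub_add_le (r : ℝ) (t : Fock) {e : ℝ}
    (he : ∀ N, ∑ k ∈ Finset.range N, (2 * (k : ℝ) + 1) * ‖(inner ℂ (ket k) t : ℂ)‖ ^ 2 ≤ e) :
    ‖displacement r t - t‖ ^ 2 + ‖displacement (r * Complex.I) t - t‖ ^ 2 ≤ 2 * r ^ 2 * e := by
  have hlim : Filter.Tendsto (fun N : ℕ => incl (∑ k ∈ Finset.range N, t k • fket k))
      Filter.atTop (nhds t) := by
    simpa only [map_sum, map_smul, incl_fket] using (hasSum_smul_ket t).tendsto_sum_nat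
  have hc : Continuous fun y : Fock =>
      ‖displacement r y - y‖ ^ 2 + ‖displacement (r * Complex.I) y - y‖ ^ 2 := by fun_prop
  refine le_of_tendsto' ((hc.tendsto t).comp hlim) fun N => ?_
  refine (norm_sq_displacement_sub_add_le_finVec r _).trans ?_
  rw [norm_sq_creation_add_annihilation]
  have := he N
  simp only [inner_ket_left] at this
  gcongr

/-- The mean photon number is the mean of the photon-number distribution. -/
lemma meanPhoton_eq_tsum (ρ : Op) :
    meanPhoton ρ = ∑' n : ℕ, ENNReal.ofReal (n * diagEntry ρ n) := by
  refine tsum_congr fun n => ?_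
  rw [creation_annihilation_fket, map_smul, map_smul, incl_fket, inner_smul_right, diagEntry,
    ← Complex.ofReal_natCast, Complex.re_ofReal_mul]

lemma hasSum_meanPhoton {ρ : Op} (hρ : ρ.IsPositive) (h : meanPhoton ρ ≠ ∞) :
    HasSum (fun n : ℕ => n * diagEntry ρ n) (meanPhoton ρ).toReal := by
  rw [meanPhoton_eq_tsum] at h ⊢
  have := ENNReal.hasSum_toReal h
  rw [← ENNReal.tsum_toReal_eq fun _ => ENNReal.ofReal_ne_top] at this
  refine this.congr_fun fun n => ?_
  rw [ENNReal.toReal_ofReal (mul_nonneg n.cast_nonneg (diagEntry_nonneg hρ n))]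

lemma norm_sq_displacement_sub (γ : ℂ) (x : Fock) :
    ‖displacement γ x - x‖ ^ 2 = 2 * ‖x‖ ^ 2 - 2 * (inner ℂ x (displacement γ x) : ℂ).re := by
  rw [@norm_sub_sq ℂ, norm_displacement_apply, inner_re_symm]
  simp only [RCLike.re_to_complex]
  ring

/-- The second-order energy bound: near the origin the characteristic function of a state decreases
at most as fast as the mean photon number allows. -/
lemma two_sub_re_charFunction_le {ρ : Op} (hρ : IsState ρ) (hn : meanPhoton ρ ≠ ∞) (r : ℝ) :
    2 - (charFunction ρ r).re - (charFunction ρ (r * Complex.I)).re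
      ≤ r ^ 2 * (2 * (meanPhoton ρ).toReal + 1) := by
  obtain ⟨s, hs, hd, hsum, hsρ⟩ := hρ.isPositiveTraceClass.exists_sqrt
  have htr : HasSum (fun k => ‖s (ket k)‖ ^ 2) 1 :=
    hρ.hasSum_diagEntry.congr_fun fun k => (hd k).symm
  have hχ : ∀ γ, HasSum (fun k => (inner ℂ (s (ket k)) (displacement γ (s (ket k))) : ℂ).re)
      (charFunction ρ γ).re := fun γ => by
    have := (hasSum_inner_mul_self hs hsum (displacement γ)).mapL Complex.reCLM
    rwa [hsρ] at this
  -- The energy of `ρ` is the sum of the energies of the vectors `s |n⟩`.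
  have hen : HasSum (fun k : ℕ => (2 * (k : ℝ) + 1) * ‖s (ket k)‖ ^ 2)
      (2 * (meanPhoton ρ).toReal + 1) := by
    refine (((hasSum_meanPhoton hρ.1 hn).mul_left 2).add htr).congr_fun fun k => ?_
    rw [hd]; ring
  have hcol : ∀ k : ℕ, HasSum
      (fun n => (2 * (k : ℝ) + 1) * ‖(inner ℂ (ket k) (s (ket n)) : ℂ)‖ ^ 2)
      ((2 * (k : ℝ) + 1) * ‖s (ket k)‖ ^ 2) := fun k => by
    refine ((hasSum_norm_sq_inner_ket (s (ket k))).mul_left _).congr_fun fun n => ?_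
    rw [← inner_map_comm hs, norm_inner_symm]
  have harr : Summable fun p : ℕ × ℕ =>
      (2 * (p.1 : ℝ) + 1) * ‖(inner ℂ (ket p.1) (s (ket p.2)) : ℂ)‖ ^ 2 := by
    rw [summable_prod_of_nonneg fun p => by positivity]
    exact ⟨fun k => (hcol k).summable, hen.summable.congr fun k => ((hcol k).tsum_eq).symm⟩
  have harr' := (Equiv.prodComm ℕ ℕ).summable_iff.mpr harr
  have htot : HasSum (fun n => ∑' k : ℕ,
      (2 * (k : ℝ) + 1) * ‖(inner ℂ (ket k) (s (ket n)) : ℂ)‖ ^ 2)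
      (2 * (meanPhoton ρ).toReal + 1) := by
    have h1 := harr.hasSum.prod_fiberwise hcol
    rw [← h1.unique hen]
    exact ((Equiv.prodComm ℕ ℕ).hasSum_iff.mpr harr.hasSum).prod_fiberwise
      fun n => (harr'.prod_factor n).hasSum
  have hlhs := ((htr.mul_left 4).sub ((hχ r).mul_left 2)).sub ((hχ (r * Complex.I)).mul_left 2)
  have hle := hasSum_le (fun n => ?_) hlhs (htot.mul_left (2 * r ^ 2))
  · linarith
  · have := norm_sq_displacement_sub_add_le r (s (ket n)) fun N =>
      (harr'.prod_factor n).sum_le_tsum (Finset.range N) fun _ _ => by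
        positivity
    rw [norm_sq_displacement_sub, norm_sq_displacement_sub] at this
    linarith

/-- The positivity of `Tr[ρ X†X]` for a linear combination `X` of displacement operators. -/
lemma charFunction_kernel_nonneg {ρ : Op} (hρ : IsState ρ) {n : ℕ} (z γ : Fin n → ℂ) :
    0 ≤ (∑ i, ∑ j, conj (z i) * z j * (Complex.exp ((conj (γ i) * γ j - γ i * conj (γ j)) / 2) *
      charFunction ρ (γ j - γ i))).re := by
  obtain ⟨s, hs, -, hsum, hsρ⟩ := hρ.isPositiveTraceClass.exists_sqrt
  have hχ : ∀ γ, HasSum (fun k => (inner ℂ (s (ket k)) (displacement γ (s (ket k))) : ℂ))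
      (charFunction ρ γ) := fun γ => by
    have := hasSum_inner_mul_self hs hsum (displacement γ)
    rwa [hsρ] at this
  have h := hasSum_sum (s := Finset.univ) fun i (_ : i ∈ Finset.univ) =>
    hasSum_sum (s := Finset.univ) fun j (_ : j ∈ Finset.univ) =>
      ((hχ (γ j - γ i)).mul_left
        (Complex.exp ((conj (γ i) * γ j - γ i * conj (γ j)) / 2))).mul_left (conj (z i) * z j)
  refine (h.mapL Complex.reCLM).nonneg fun k => ?_
  have e : ∑ i, ∑ j, conj (z i) * z j * (Complex.exp ((conj (γ i) * γ j - γ i * conj (γ j)) / 2) *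
      inner ℂ (s (ket k)) (displacement (γ j - γ i) (s (ket k))))
      = inner ℂ (∑ i, z i • displacement (γ i) (s (ket k)))
        (∑ j, z j • displacement (γ j) (s (ket k))) := by
    rw [sum_inner]
    refine Finset.sum_congr rfl fun i _ => ?_
    rw [inner_sum]
    refine Finset.sum_congr rfl fun j _ => ?_
    have h := DFunLike.congr_fun (adjoint_displacement_mul (γ i) (γ j)) (s (ket k))
    rw [mul_apply_eq_comp, smul_apply] at h
    rw [inner_smul_left, inner_smul_right,
      ← ContinuousLinearMap.adjoint_inner_right (displacement (γ i)), h, inner_smul_right,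
      mul_assoc]
  rw [e]
  exact inner_self_nonneg (𝕜 := ℂ)

/-! ### The uncertainty relation and the energy of Gaussian states -/

section Gaussian

variable {ρ : Op} {a b c u v : ℝ}

lemma re_cexp_neg_add_I_mul (x y : ℝ) :
    (Complex.exp (-(x : ℂ) + Complex.I * (y : ℂ))).re = Real.exp (-x) * Real.cos y := by
  simp [Complex.exp_re]

/-- The Weyl phase is imaginary: it is the symplectic form of the two displacements. -/
lemma weyl_exponent_eq (z ζ : ℂ) (q : ℝ) :
    (conj z * ζ - z * conj ζ) / 2 - (q : ℂ)
      = ((-q : ℝ) : ℂ) + ((z.re * ζ.im - z.im * ζ.re : ℝ) : ℂ) * Complex.I := by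
  apply Complex.ext
  · simp
  · simp; ring

/-- The positivity condition depends only on the quadratic part of the exponent. -/
lemma gaussian_kernel_nonneg (hρ : IsState ρ)
    (hχ : ∀ γ : ℂ, charFunction ρ γ = Complex.exp
      (-((a * γ.re ^ 2 + 2 * b * γ.re * γ.im + c * γ.im ^ 2 : ℝ) : ℂ)
        + Complex.I * ((u * γ.re + v * γ.im : ℝ) : ℂ))) {n : ℕ} (z γ : Fin n → ℂ) :
    0 ≤ (∑ i, ∑ j, conj (z i) * z j * Complex.exp ((conj (γ i) * γ j - γ i * conj (γ j)) / 2
      - ((a * (γ j - γ i).re ^ 2 + 2 * b * (γ j - γ i).re * (γ j - γ i).im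
        + c * (γ j - γ i).im ^ 2 : ℝ) : ℂ))).re := by
  -- The linear part of the exponent is absorbed into the phases of the coefficients.
  have h := charFunction_kernel_nonneg hρ
    (fun i => z i * Complex.exp (-(Complex.I * ((u * (γ i).re + v * (γ i).im : ℝ) : ℂ)))) γ
  refine h.trans_eq (congrArg Complex.re (Finset.sum_congr rfl fun i _ =>
    Finset.sum_congr rfl fun j _ => ?_))
  rw [hχ, map_mul, ← Complex.exp_conj]
  have : ∀ w₁ w₂ x y p q : ℂ, w₁ * Complex.exp p * (w₂ * Complex.exp q)
      * (Complex.exp x * Complex.exp y) = w₁ * w₂ * Complex.exp (p + q + x + y) := by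
    intro w₁ w₂ x y p q
    rw [Complex.exp_add, Complex.exp_add, Complex.exp_add]; ring
  rw [this]
  congr 2
  simp only [map_neg, map_mul, Complex.conj_I, Complex.conj_ofReal, Complex.sub_re, Complex.sub_im]
  push_cast
  ring

/-- The uncertainty relation for the covariance matrix of a Gaussian state: positivity of
`Tr[ρ X†X]` for combinations `X` of `1`, `D(r)`, `D(ir)`, to first order in `r²`. -/
lemma uncertainty_relation (hρ : IsState ρ) (hc : 0 < c)
    (hχ : ∀ γ : ℂ, charFunction ρ γ = Complex.exp
      (-((a * γ.re ^ 2 + 2 * b * γ.re * γ.im + c * γ.im ^ 2 : ℝ) : ℂ)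
        + Complex.I * ((u * γ.re + v * γ.im : ℝ) : ℂ))) :
    1 / 4 ≤ a * c - b ^ 2 := by
  -- The coefficients of `1`, `D(r)`, `D(ir)` are `2b - 2c - i`, `2c`, `-2b + i`. Their sum is zero,
  -- so `Tr[ρ X†X]`, which is `F(r²)`, vanishes at `r = 0`; given the second coefficient, the third
  -- one minimizes the derivative of `F` there.
  set F : ℝ → ℝ := fun τ => (2 * b - 2 * c) ^ 2 + 2 + 4 * c ^ 2 + 4 * b ^ 2
    + 4 * c * (2 * b - 2 * c) * Real.exp (-a * τ)
    + 2 * (-4 * b ^ 2 + 4 * b * c - 1) * Real.exp (-c * τ)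
    + 4 * c * ((-2 * b * Real.cos τ - Real.sin τ) * Real.exp (-(a + c - 2 * b) * τ)) with hF
  have hnonneg : ∀ r : ℝ, 0 ≤ F (r ^ 2) := by
    intro r
    have h := gaussian_kernel_nonneg hρ hχ
      ![2 * b - 2 * c - Complex.I, 2 * c, -2 * b + Complex.I] ![0, r, r * Complex.I]
    refine h.trans_eq ?_
    simp only [Fin.sum_univ_three, Matrix.cons_val_zero, Matrix.cons_val_one, Matrix.cons_val]
    simp only [weyl_exponent_eq]
    simp [Complex.exp_re, Complex.exp_im, hF, -Complex.ofReal_pow]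
    ring_nf
  have hderiv : HasDerivAt F (2 * c * (4 * (a * c - b ^ 2) - 1)) 0 := by
    have he : ∀ k : ℝ, HasDerivAt (fun τ => Real.exp (k * τ)) k 0 := fun k => by
      simpa using ((hasDerivAt_id (0 : ℝ)).const_mul k).exp
    have hcs := ((Real.hasDerivAt_cos 0).const_mul (-2 * b)).sub (Real.hasDerivAt_sin 0)
    have := ((((he (-a)).const_mul (4 * c * (2 * b - 2 * c))).const_add
      ((2 * b - 2 * c) ^ 2 + 2 + 4 * c ^ 2 + 4 * b ^ 2)).add
      ((he (-c)).const_mul (2 * (-4 * b ^ 2 + 4 * b * c - 1)))).add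
      ((hcs.mul (he (-(a + c - 2 * b)))).const_mul (4 * c))
    refine this.congr_deriv ?_
    simp
    ring
  have h0 : F 0 = 0 := by simp [hF]; ring
  have hge : 0 ≤ 2 * c * (4 * (a * c - b ^ 2) - 1) := by
    refine ge_of_tendsto hderiv.tendsto_slope_zero_right ?_
    filter_upwards [self_mem_nhdsWithin] with t ht
    have ht0 : 0 < t := ht
    have := hnonneg (Real.sqrt t)
    rw [Real.sq_sqrt ht0.le] at this
    rw [zero_add, h0, sub_zero, smul_eq_mul]
    positivity
  have := nonneg_of_mul_nonneg_right hge (by positivity)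
  linarith

lemma tendsto_one_sub_exp_mul_cos_div (a u : ℝ) :
    Filter.Tendsto (fun r : ℝ => (1 - Real.exp (-(a * r ^ 2)) * Real.cos (u * r)) / r ^ 2)
      (nhdsWithin 0 (Set.Ioi 0)) (nhds (a + u ^ 2 / 2)) := by
  have hsq : Filter.Tendsto (fun r : ℝ => r ^ 2) (nhdsWithin 0 (Set.Ioi 0))
      (nhdsWithin 0 (Set.Ioi 0)) := by
    refine tendsto_nhdsWithin_iff.mpr ⟨?_, ?_⟩
    · have : Filter.Tendsto (fun r : ℝ => r ^ 2) (nhds 0) (nhds (0 ^ 2)) :=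
        (continuous_pow 2).tendsto 0
      rw [zero_pow two_ne_zero] at this
      exact this.mono_left nhdsWithin_le_nhds
    · filter_upwards [self_mem_nhdsWithin] with r hr
      exact pow_pos (show 0 < r from hr) 2
  have h1 : HasDerivAt (fun τ : ℝ => Real.exp (-(a * τ))) (-a) 0 := by
    simpa using (((hasDerivAt_id (0 : ℝ)).const_mul a).neg).exp
  have h2 : HasDerivAt (fun r : ℝ => Real.sin (u / 2 * r)) (u / 2) 0 := by
    simpa using ((hasDerivAt_id (0 : ℝ)).const_mul (u / 2)).sin
  have t1 := h1.tendsto_slope_zero_right.comp hsq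
  have t2 := h2.tendsto_slope_zero_right
  have t3 : Filter.Tendsto (fun r : ℝ => Real.exp (-(a * r ^ 2))) (nhdsWithin 0 (Set.Ioi 0))
      (nhds 1) := by
    have : Continuous fun r : ℝ => Real.exp (-(a * r ^ 2)) := by fun_prop
    have := this.tendsto 0
    simp only [ne_eq, OfNat.ofNat_ne_zero, not_false_eq_true, zero_pow, mul_zero, neg_zero,
      Real.exp_zero] at this
    exact this.mono_left nhdsWithin_le_nhds
  have t4 := t1.neg.add (((t2.pow 2).const_mul 2).mul t3)
  have e : - -a + 2 * (u / 2) ^ 2 * 1 = a + u ^ 2 / 2 := by ring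
  rw [e] at t4
  refine t4.congr' ?_
  filter_upwards [self_mem_nhdsWithin] with r hr
  have hr0 : r ≠ 0 := ne_of_gt hr
  have hcos : Real.cos (u * r) = 1 - 2 * Real.sin (u / 2 * r) ^ 2 := by
    rw [show u * r = 2 * (u / 2 * r) by ring, Real.cos_two_mul, Real.cos_sq']; ring
  simp only [Function.comp_apply, zero_add, mul_zero, neg_zero, Real.exp_zero, Real.sin_zero,
    smul_eq_mul, hcos, sub_zero]
  field_simp
  ring

/-- A lower bound for the mean photon number of a Gaussian state, in terms of its covariance matrix
and its displacement. -/
lemma le_two_mul_meanPhoton_add_one (hρ : IsState ρ) (hn : meanPhoton ρ ≠ ∞)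
    (hχ : ∀ γ : ℂ, charFunction ρ γ = Complex.exp
      (-((a * γ.re ^ 2 + 2 * b * γ.re * γ.im + c * γ.im ^ 2 : ℝ) : ℂ)
        + Complex.I * ((u * γ.re + v * γ.im : ℝ) : ℂ))) :
    a + c + (u ^ 2 + v ^ 2) / 2 ≤ 2 * (meanPhoton ρ).toReal + 1 := by
  have hlim := (tendsto_one_sub_exp_mul_cos_div a u).add (tendsto_one_sub_exp_mul_cos_div c v)
  refine le_trans (le_of_eq (by ring)) (le_of_tendsto hlim (b := 2 * (meanPhoton ρ).toReal + 1) ?_)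
  filter_upwards [self_mem_nhdsWithin] with r hr
  have hr0 : 0 < r := hr
  have h := two_sub_re_charFunction_le hρ hn r
  rw [hχ, hχ, re_cexp_neg_add_I_mul, re_cexp_neg_add_I_mul] at h
  simp only [Complex.ofReal_re, Complex.ofReal_im, Complex.re_ofReal_mul, Complex.im_ofReal_mul,
    Complex.I_re, Complex.I_im, mul_zero, mul_one, zero_pow two_ne_zero, add_zero, zero_add,
    zero_mul] at h
  rw [← add_div, div_le_iff₀ (by positivity)]
  linarith

end Gaussian

/-! ### The Wigner function of a Gaussian state at the origin -/

section GaussianIntegral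

open MeasureTheory

variable {a b c : ℝ}

lemma integrable_gaussian_prod (ha : 0 < a) (hD : 0 < a * c - b ^ 2) (u v : ℝ) :
    Integrable (fun p : ℝ × ℝ => Complex.exp
      (-((a * p.1 ^ 2 + 2 * b * p.1 * p.2 + c * p.2 ^ 2 : ℝ) : ℂ)
        + Complex.I * ((u * p.1 + v * p.2 : ℝ) : ℂ))) := by
  have hc : 0 < c := by
    by_contra! h
    nlinarith [sq_nonneg b, mul_nonneg ha.le (neg_nonneg.mpr h)]
  -- The quadratic form dominates `κ (x² + y²)` for `κ = det / trace`.
  set κ : ℝ := (a * c - b ^ 2) / (a + c) with hκ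
  have hκ0 : 0 < κ := by positivity
  have hκe : κ * (a + c) = a * c - b ^ 2 := by rw [hκ]; field_simp
  have hac : κ < a := by
    rw [hκ, div_lt_iff₀ (by positivity)]
    nlinarith [sq_nonneg b, sq_pos_of_pos ha]
  have hint := (integrable_exp_neg_mul_sq hκ0).mul_prod (integrable_exp_neg_mul_sq hκ0)
  refine hint.mono' (by fun_prop) (Filter.Eventually.of_forall fun p => ?_)
  rw [Complex.norm_exp, ← Real.exp_add]
  refine Real.exp_le_exp.mpr ?_
  simp only [Complex.add_re, Complex.neg_re, Complex.ofReal_re, Complex.mul_re, Complex.I_re,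
    Complex.I_im, Complex.ofReal_im, zero_mul, mul_zero, sub_zero, add_zero]
  have h1 : 0 ≤ (a - κ) * ((a - κ) * p.1 ^ 2 + 2 * b * p.1 * p.2 + (c - κ) * p.2 ^ 2) := by
    have : (a - κ) * ((a - κ) * p.1 ^ 2 + 2 * b * p.1 * p.2 + (c - κ) * p.2 ^ 2)
        = ((a - κ) * p.1 + b * p.2) ^ 2 + κ ^ 2 * p.2 ^ 2 := by
      linear_combination (-p.2 ^ 2) * hκe
    rw [this]; positivity
  have h2 := nonneg_of_mul_nonneg_right h1 (sub_pos.mpr hac)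
  linarith

lemma cpow_half_eq_sqrt {x : ℝ} (hx : 0 ≤ x) : (x : ℂ) ^ (1 / 2 : ℂ) = (Real.sqrt x : ℂ) := by
  rw [Real.sqrt_eq_rpow, Complex.ofReal_cpow hx]
  norm_num

/-- The Gaussian integral in two variables with a linear phase. -/
lemma integral_gaussian_prod (ha : 0 < a) (hD : 0 < a * c - b ^ 2) (u v : ℝ) :
    ∫ p : ℝ × ℝ, Complex.exp
      (-((a * p.1 ^ 2 + 2 * b * p.1 * p.2 + c * p.2 ^ 2 : ℝ) : ℂ)
        + Complex.I * ((u * p.1 + v * p.2 : ℝ) : ℂ))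
      = ((Real.pi / Real.sqrt (a * c - b ^ 2) * Real.exp
        (-((c * u ^ 2 - 2 * b * u * v + a * v ^ 2) / (4 * (a * c - b ^ 2)))) : ℝ) : ℂ) := by
  have hc : 0 < c := by
    by_contra! h
    nlinarith [sq_nonneg b, mul_nonneg ha.le (neg_nonneg.mpr h)]
  have hc' : (c : ℂ) ≠ 0 := by exact_mod_cast hc.ne'
  have hD' : (a * c - b ^ 2 : ℂ) ≠ 0 := by exact_mod_cast hD.ne'
  rw [Measure.volume_eq_prod, integral_prod _ (integrable_gaussian_prod ha hD u v)]
  have hinner : ∀ x : ℝ, ∫ y : ℝ, Complex.exp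
      (-((a * x ^ 2 + 2 * b * x * y + c * y ^ 2 : ℝ) : ℂ)
        + Complex.I * ((u * x + v * y : ℝ) : ℂ))
      = (Real.sqrt (Real.pi / c) : ℂ) * Complex.exp (-(((a * c - b ^ 2) / c : ℝ) : ℂ) * (x : ℂ) ^ 2
        + (Complex.I * ((u - b * v / c : ℝ) : ℂ)) * (x : ℂ) + ((-v ^ 2 / (4 * c) : ℝ) : ℂ)) := by
    intro x
    have h := integral_cexp_quadratic (b := -(c : ℂ)) (by simpa using hc)
      (-2 * b * x + Complex.I * v) (-a * x ^ 2 + Complex.I * u * x)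
    rw [neg_neg, ← Complex.ofReal_div, cpow_half_eq_sqrt (by positivity)] at h
    refine Eq.trans ?_ (h.trans ?_)
    · refine integral_congr_ae (Filter.Eventually.of_forall fun y => ?_)
      simp only
      congr 1
      push_cast
      ring
    · congr 2
      push_cast
      field_simp
      ring_nf
      simp only [Complex.I_sq]
      ring
  simp only [hinner]
  rw [integral_const_mul, integral_cexp_quadratic (b := -(((a * c - b ^ 2) / c : ℝ) : ℂ))
    (by rw [Complex.neg_re, Complex.ofReal_re]; exact neg_neg_of_pos (div_pos hD hc)), neg_neg,
    ← Complex.ofReal_div,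
    cpow_half_eq_sqrt (by positivity), ← mul_assoc, ← Complex.ofReal_mul,
    ← Real.sqrt_mul (by positivity), Complex.ofReal_mul, Complex.ofReal_exp]
  congr 2
  · rw [show Real.pi / c * (Real.pi / ((a * c - b ^ 2) / c)) = Real.pi ^ 2 / (a * c - b ^ 2) by
      field_simp, Real.sqrt_div (by positivity), Real.sqrt_sq Real.pi_pos.le]
  · push_cast
    generalize hE : (a : ℂ) * c - (b : ℂ) ^ 2 = E at hD' ⊢
    field_simp
    ring_nf
    simp only [Complex.I_sq]
    linear_combination (v : ℂ) ^ 2 * hE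

lemma integrable_gaussian_complex (ha : 0 < a) (hD : 0 < a * c - b ^ 2) (u v : ℝ) :
    Integrable (fun γ : ℂ => Complex.exp
      (-((a * γ.re ^ 2 + 2 * b * γ.re * γ.im + c * γ.im ^ 2 : ℝ) : ℂ)
        + Complex.I * ((u * γ.re + v * γ.im : ℝ) : ℂ))) :=
  (Complex.volume_preserving_equiv_real_prod.integrable_comp_emb
    Complex.measurableEquivRealProd.measurableEmbedding).mpr (integrable_gaussian_prod ha hD u v)

lemma integral_gaussian_complex (ha : 0 < a) (hD : 0 < a * c - b ^ 2) (u v : ℝ) :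
    ∫ γ : ℂ, Complex.exp
      (-((a * γ.re ^ 2 + 2 * b * γ.re * γ.im + c * γ.im ^ 2 : ℝ) : ℂ)
        + Complex.I * ((u * γ.re + v * γ.im : ℝ) : ℂ))
      = ((Real.pi / Real.sqrt (a * c - b ^ 2) * Real.exp
        (-((c * u ^ 2 - 2 * b * u * v + a * v ^ 2) / (4 * (a * c - b ^ 2)))) : ℝ) : ℂ) := by
  rw [← integral_gaussian_prod ha hD u v]
  exact Complex.volume_preserving_equiv_real_prod.integral_comp
    Complex.measurableEquivRealProd.measurableEmbedding (fun p : ℝ × ℝ => Complex.exp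
      (-((a * p.1 ^ 2 + 2 * b * p.1 * p.2 + c * p.2 ^ 2 : ℝ) : ℂ)
        + Complex.I * ((u * p.1 + v * p.2 : ℝ) : ℂ)))

/-- The elementary inequality behind the bound for Gaussian states: the exponent of the Wigner
function and the logarithm of the determinant are controlled by the mean photon number. Here
`(a + c + d) / 2` is the larger eigenvalue of the covariance matrix. -/
lemma gaussian_exponent_le (ha : 0 < a) (hc : 0 < c) (hD : 1 / 4 ≤ a * c - b ^ 2) {u v n : ℝ}
    (hn : a + c + (u ^ 2 + v ^ 2) / 2 ≤ 2 * n + 1) :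
    (c * u ^ 2 - 2 * b * u * v + a * v ^ 2) / (4 * (a * c - b ^ 2))
      + Real.log (4 * (a * c - b ^ 2)) / 2 ≤ 2 * n * (1 + n) := by
  set D := a * c - b ^ 2 with hDdef
  have hD0 : 0 < D := by linarith
  have hdisc : 0 ≤ (a - c) ^ 2 + 4 * b ^ 2 := by positivity
  set d := Real.sqrt ((a - c) ^ 2 + 4 * b ^ 2) with hd
  have hd0 : 0 ≤ d := Real.sqrt_nonneg _
  have hd2 : d ^ 2 = (a - c) ^ 2 + 4 * b ^ 2 := Real.sq_sqrt hdisc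
  have hquad : c * u ^ 2 - 2 * b * u * v + a * v ^ 2 ≤ (a + c + d) / 2 * (u ^ 2 + v ^ 2) := by
    rcases hd0.eq_or_lt with h0 | h0
    · rw [← h0, zero_pow two_ne_zero] at hd2
      have hb : b = 0 := by nlinarith [sq_nonneg (a - c), sq_nonneg b]
      have hac : a - c = 0 := by nlinarith [sq_nonneg (a - c), sq_nonneg b]
      rw [← h0, hb, show a = c by linarith]
      nlinarith
    · have key : d * ((a + c + d) / 2 * (u ^ 2 + v ^ 2) - (c * u ^ 2 - 2 * b * u * v + a * v ^ 2))
          = ((a - c + d) / 2 * u + b * v) ^ 2 + (b * u + (c - a + d) / 2 * v) ^ 2 := by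
        linear_combination ((u ^ 2 + v ^ 2) / 4) * hd2
      have hk : 0 ≤ d * ((a + c + d) / 2 * (u ^ 2 + v ^ 2)
          - (c * u ^ 2 - 2 * b * u * v + a * v ^ 2)) := by
        rw [key]; positivity
      have := nonneg_of_mul_nonneg_right hk h0
      linarith
  have hlog : Real.log (4 * D) ≤ 4 * D - 1 := Real.log_le_sub_one_of_pos (by positivity)
  have hfrac : (c * u ^ 2 - 2 * b * u * v + a * v ^ 2) / (4 * D)
      ≤ (a + c + d) / 2 * (u ^ 2 + v ^ 2) := by
    rw [div_le_iff₀ (by positivity)]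
    refine hquad.trans (le_mul_of_one_le_right (by positivity) (by linarith))
  have hsq : (a + c + (u ^ 2 + v ^ 2) / 2) ^ 2 ≤ (2 * n + 1) ^ 2 :=
    pow_le_pow_left₀ (by positivity) hn 2
  nlinarith [sq_nonneg (d - (u ^ 2 + v ^ 2) / 2)]

lemma gaussian_bound (ha : 0 < a) (hc : 0 < c) (hD : 1 / 4 ≤ a * c - b ^ 2) {u v n : ℝ}
    (hn : a + c + (u ^ 2 + v ^ 2) / 2 ≤ 2 * n + 1) :
    2 / Real.pi * Real.exp (-2 * n * (1 + n)) ≤ 1 / Real.pi ^ 2 *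
      (Real.pi / Real.sqrt (a * c - b ^ 2) * Real.exp
        (-((c * u ^ 2 - 2 * b * u * v + a * v ^ 2) / (4 * (a * c - b ^ 2))))) := by
  have h := gaussian_exponent_le ha hc hD hn
  set D := a * c - b ^ 2 with hDdef
  have hD0 : 0 < D := by linarith
  set X := (c * u ^ 2 - 2 * b * u * v + a * v ^ 2) / (4 * D) with hX
  have hs : 0 < Real.sqrt D := Real.sqrt_pos.mpr hD0
  have h2 : Real.exp (Real.log (4 * D) / 2) = 2 * Real.sqrt D := by
    rw [← Real.log_sqrt (by positivity), Real.exp_log (Real.sqrt_pos.mpr (by positivity)),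
      Real.sqrt_mul (by norm_num), show (4 : ℝ) = 2 ^ 2 by norm_num, Real.sqrt_sq (by norm_num)]
  have h3 : 2 * Real.sqrt D * Real.exp (-2 * n * (1 + n)) ≤ Real.exp (-X) := by
    rw [← h2, ← Real.exp_add]
    exact Real.exp_le_exp.mpr (by linarith)
  have e : 1 / Real.pi ^ 2 * (Real.pi / Real.sqrt D * Real.exp (-X))
      = 1 / Real.pi * (Real.exp (-X) / Real.sqrt D) := by
    have := Real.pi_pos.ne'
    field_simp
  rw [e, div_mul_eq_mul_div, div_mul_eq_mul_div, one_mul]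
  refine div_le_div_of_nonneg_right ?_ Real.pi_pos.le
  rw [le_div_iff₀ hs]
  linarith

end GaussianIntegral

/-! ### The bound for Gaussian states -/

open MeasureTheory

lemma wigner_zero (ρ : Op) :
    wigner ρ 0 = ((1 / Real.pi ^ 2 : ℝ) : ℂ) * ∫ γ, charFunction ρ γ := by
  rw [wigner, ← integral_const_mul]
  simp

/-- The properties of a state that mixtures inherit and that Gaussian states have. The bound on the
`L¹` norm of the characteristic function, which the uncertainty relation provides, makes Fubini's
theorem applicable to mixtures. -/
structure HasWignerBound (ρ : Op) : Prop where
  isState : IsState ρ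
  integrable : Integrable (charFunction ρ)
  integral_norm_le : ∫ γ, ‖charFunction ρ γ‖ ≤ 2 * Real.pi
  im_eq_zero : (wigner ρ 0).im = 0
  re_nonneg : 0 ≤ (wigner ρ 0).re
  le_re : meanPhoton ρ ≠ ∞ → 2 / Real.pi * Real.exp (-2 * (meanPhoton ρ).toReal *
    (1 + (meanPhoton ρ).toReal)) ≤ (wigner ρ 0).re

lemma IsGaussianState.hasWignerBound {ρ : Op} (hρ : IsGaussianState ρ) : HasWignerBound ρ := by
  obtain ⟨hst, a, b, c, u, v, ha, hD, hχ⟩ := hρ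
  have hc : 0 < c := by
    by_contra! h
    nlinarith [sq_nonneg b, mul_nonneg ha.le (neg_nonneg.mpr h)]
  have hunc := uncertainty_relation hst hc hχ
  have hχ' := funext hχ
  have hW : wigner ρ 0 = ((1 / Real.pi ^ 2 * (Real.pi / Real.sqrt (a * c - b ^ 2) * Real.exp
      (-((c * u ^ 2 - 2 * b * u * v + a * v ^ 2) / (4 * (a * c - b ^ 2))))) : ℝ) : ℂ) := by
    rw [wigner_zero, hχ', integral_gaussian_complex ha hD, ← Complex.ofReal_mul]
  have hnorm : ∀ γ, ((‖charFunction ρ γ‖ : ℝ) : ℂ) = Complex.exp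
      (-((a * γ.re ^ 2 + 2 * b * γ.re * γ.im + c * γ.im ^ 2 : ℝ) : ℂ)
        + Complex.I * ((0 * γ.re + 0 * γ.im : ℝ) : ℂ)) := by
    intro γ
    rw [hχ, Complex.norm_exp]
    simp only [Complex.add_re, Complex.neg_re, Complex.ofReal_re, Complex.mul_re, Complex.I_re,
      Complex.I_im, Complex.ofReal_im, zero_mul, mul_zero, sub_zero, add_zero, Complex.ofReal_zero,
      Complex.ofReal_exp, Complex.ofReal_neg]
  refine ⟨hst, hχ' ▸ integrable_gaussian_complex ha hD u v, ?_, by rw [hW, Complex.ofReal_im], ?_,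
    fun hn => ?_⟩
  · have h1 : ((∫ γ, ‖charFunction ρ γ‖ : ℝ) : ℂ) = _ := integral_complex_ofReal.symm.trans
      ((integral_congr_ae (Filter.Eventually.of_forall hnorm)).trans
        (integral_gaussian_complex ha hD 0 0))
    rw [Complex.ofReal_inj.mp h1]
    have hs : 1 / 2 ≤ Real.sqrt (a * c - b ^ 2) := Real.le_sqrt_of_sq_le (by linarith)
    simp only [ne_eq, OfNat.ofNat_ne_zero, not_false_eq_true, zero_pow, mul_zero, sub_self,
      add_zero, zero_div, neg_zero, Real.exp_zero, mul_one]
    rw [div_le_iff₀ (by linarith)]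
    nlinarith [Real.pi_pos]
  · rw [hW, Complex.ofReal_re]
    positivity
  · rw [hW, Complex.ofReal_re]
    exact gaussian_bound ha hc hunc (le_two_mul_meanPhoton_add_one hst hn hχ)

lemma continuous_displacementTerm (n k : ℕ) : Continuous fun γ => displacementTerm γ n k := by
  have h : Continuous fun γ => incl ((displacementExponent γ ^ k) (fket n)) := by
    induction k generalizing n with
    | zero => simpa using continuous_const
    | succ k ih =>
      have e : ∀ γ, incl ((displacementExponent γ ^ (k + 1)) (fket n))
          = (γ * ((Real.sqrt (n + 1) : ℝ) : ℂ)) • incl ((displacementExponent γ ^ k) (fket (n + 1)))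
            - (conj γ * ((Real.sqrt n : ℝ) : ℂ)) •
              incl ((displacementExponent γ ^ k) (fket (n - 1))) := by
        intro γ
        conv_lhs => rw [pow_succ, Module.End.mul_apply, displacementExponent]
        simp only [LinearMap.sub_apply, LinearMap.smul_apply, creation_fket, annihilation_fket,
          map_sub, map_smul, smul_smul]
        rfl
      simp only [e]
      exact ((continuous_id.mul continuous_const).smul (ih _)).sub
        ((Complex.continuous_conj.mul continuous_const).smul (ih _))
  exact h.const_smul ((k.factorial : ℂ)⁻¹)

lemma measurable_inner_displacement_ket (m n : ℕ) :
    Measurable fun γ => (inner ℂ (ket m) (displacement γ (ket n)) : ℂ) := by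
  refine measurable_of_tendsto_metrizable
    (f := fun N γ => ∑ k ∈ Finset.range N, (inner ℂ (ket m) (displacementTerm γ n k) : ℂ))
    (fun N => Finset.measurable_sum _ fun k _ => Continuous.measurable
      (continuous_const.inner (continuous_displacementTerm n k))) ?_
  refine tendsto_pi_nhds.mpr fun γ => ?_
  rw [displacement_ket]
  exact ((hasSum_displacedKet γ n).mapL (innerSL ℂ (ket m))).tendsto_sum_nat

/-- For a contraction `B`, the series defining `Tr[ρ B]` is absolutely bounded by `Tr ρ = 1`. -/
lemma tsum_enorm_inner_mul_le_one {ρ : Op} (hρ : IsState ρ) {B : Op} (hB : ‖B‖ ≤ 1) :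
    ∑' n, ‖(inner ℂ (ket n) (ρ (B (ket n))) : ℂ)‖ₑ ≤ 1 := by
  obtain ⟨s, hs, hd, hsum, rfl⟩ := hρ.isPositiveTraceClass.exists_sqrt
  have h := tsum_norm_inner_mul_self_le hs hsum hB
  simp only [← hd, hρ.hasSum_diagEntry.tsum_eq] at h
  simp only [← ofReal_norm]
  rw [← ENNReal.ofReal_tsum_of_nonneg (fun _ => norm_nonneg _)
    (summable_norm_inner_mul_self hs hsum B)]
  exact ENNReal.ofReal_le_one.mpr h

lemma convexOn_exp_neg_mul_one_add :
    ConvexOn ℝ (Set.Ici 0) fun n : ℝ => 2 / Real.pi * Real.exp (-2 * n * (1 + n)) := by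
  have hd : ∀ n : ℝ, HasDerivAt (fun n : ℝ => Real.exp (-2 * n * (1 + n)))
      (-(2 + 4 * n) * Real.exp (-2 * n * (1 + n))) n := fun n => by
    have := (((hasDerivAt_id n).const_mul (-2)).mul ((hasDerivAt_id n).const_add 1)).exp
    refine this.congr_deriv ?_
    simp only [id, Pi.mul_apply]
    ring
  have hd2 : ∀ n : ℝ, HasDerivAt (fun n : ℝ => -(2 + 4 * n) * Real.exp (-2 * n * (1 + n)))
      ((16 * n + 16 * n ^ 2) * Real.exp (-2 * n * (1 + n))) n := fun n => by
    have := ((((hasDerivAt_id n).const_mul 4).const_add 2).neg).mul (hd n)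
    refine this.congr_deriv ?_
    simp only [id, Pi.neg_apply]
    ring
  refine ConvexOn.smul (by positivity) (convexOn_of_hasDerivWithinAt2_nonneg (convex_Ici 0)
    (by fun_prop) (fun n _ => (hd n).hasDerivWithinAt) (fun n _ => (hd2 n).hasDerivWithinAt)
    fun n hn => ?_)
  rw [interior_Ici] at hn
  have : 0 < n := hn
  positivity

/-! ### Mixtures -/

section Mixture

variable {Ω : Type*} [MeasurableSpace Ω] {P : Measure Ω} {S : Ω → Op} {T : Op}

/-- The operator `T` is the entrywise integral of the operators `S ω`. -/
def IsEntrywiseIntegral (P : Measure Ω) (S : Ω → Op) (T : Op) : Prop :=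
  ∀ x y : Fock, Integrable (fun ω => (inner ℂ x (S ω y) : ℂ)) P ∧
    inner ℂ x (T y) = ∫ ω, (inner ℂ x (S ω y) : ℂ) ∂P

namespace IsEntrywiseIntegral

variable (hT : IsEntrywiseIntegral P S T)
include hT

lemma isPositive (hS : ∀ᵐ ω ∂P, (S ω).IsPositive) : T.IsPositive := by
  refine isPositive_of_inner_nonneg fun x => ?_
  rw [(hT x x).2]
  exact integral_nonneg_of_ae (hS.mono fun ω hω => hω.inner_nonneg_right x)

lemma integrable_diagEntry (n : ℕ) : Integrable (fun ω => diagEntry (S ω) n) P :=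
  (hT (ket n) (ket n)).1.re

lemma diagEntry_eq (n : ℕ) : diagEntry T n = ∫ ω, diagEntry (S ω) n ∂P := by
  rw [diagEntry, (hT (ket n) (ket n)).2]
  exact (Complex.reCLM.integral_comp_comm (hT (ket n) (ket n)).1).symm

lemma tsum_ofReal_mul_diagEntry (hS : ∀ᵐ ω ∂P, (S ω).IsPositive) (w : ℕ → ℝ) (hw : ∀ n, 0 ≤ w n) :
    ∑' n, ENNReal.ofReal (w n * diagEntry T n)
      = ∫⁻ ω, ∑' n, ENNReal.ofReal (w n * diagEntry (S ω) n) ∂P := by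
  rw [lintegral_tsum fun n =>
    ((hT.integrable_diagEntry n).const_mul (w n)).aestronglyMeasurable.aemeasurable.ennreal_ofReal]
  refine tsum_congr fun n => ?_
  rw [hT.diagEntry_eq, ← integral_const_mul]
  exact ofReal_integral_eq_lintegral_ofReal ((hT.integrable_diagEntry n).const_mul (w n))
    (hS.mono fun ω hω => mul_nonneg (hw n) (diagEntry_nonneg hω n))

lemma meanPhoton_eq (hS : ∀ᵐ ω ∂P, (S ω).IsPositive) :
    meanPhoton T = ∫⁻ ω, meanPhoton (S ω) ∂P := by
  simp only [meanPhoton_eq_tsum]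
  exact hT.tsum_ofReal_mul_diagEntry hS _ fun n => n.cast_nonneg

lemma aemeasurable_meanPhoton : AEMeasurable (fun ω => meanPhoton (S ω)) P := by
  simp only [meanPhoton_eq_tsum]
  exact AEMeasurable.tsum fun n => ((hT.integrable_diagEntry n).const_mul
    (n : ℝ)).aestronglyMeasurable.aemeasurable.ennreal_ofReal

lemma isState [IsProbabilityMeasure P] (hS : ∀ᵐ ω ∂P, IsState (S ω)) : IsState T := by
  have hpos := hT.isPositive (hS.mono fun ω hω => hω.1)
  have h1 : ∑' n, ENNReal.ofReal (diagEntry T n) = 1 := by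
    have := hT.tsum_ofReal_mul_diagEntry (hS.mono fun ω hω => hω.1) (fun _ => 1)
      (fun _ => zero_le_one)
    simp only [one_mul] at this
    rw [this, lintegral_congr_ae (g := fun _ => 1) (hS.mono fun ω hω => ?_)]
    · simp
    · rw [← ENNReal.ofReal_tsum_of_nonneg (diagEntry_nonneg hω.1) hω.hasSum_diagEntry.summable,
        hω.hasSum_diagEntry.tsum_eq, ENNReal.ofReal_one]
  have h2 : HasSum (diagEntry T) 1 := by
    have := ENNReal.hasSum_toReal (h1 ▸ ENNReal.one_ne_top)
    rw [← ENNReal.tsum_toReal_eq fun _ => ENNReal.ofReal_ne_top, h1, ENNReal.toReal_one] at this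
    exact this.congr_fun fun n => (ENNReal.toReal_ofReal (diagEntry_nonneg hpos n)).symm
  refine ⟨hpos, ?_⟩
  have h3 := h2.mapL Complex.ofRealCLM
  rw [Complex.ofRealCLM_apply, Complex.ofReal_one] at h3
  refine h3.congr_fun fun n => ?_
  have := (Complex.le_def.mp (hpos.inner_nonneg_right (ket n))).2
  exact Complex.ext rfl this.symm

lemma charFunction_eq [IsProbabilityMeasure P] (hS : ∀ᵐ ω ∂P, IsState (S ω)) (γ : ℂ) :
    charFunction T γ = ∫ ω, charFunction (S ω) γ ∂P := by
  have hm := fun n => (hT (ket n) (displacement γ (ket n))).1.aestronglyMeasurable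
  have hfin : ∑' n, ∫⁻ ω, ‖(inner ℂ (ket n) (S ω (displacement γ (ket n))) : ℂ)‖ₑ ∂P ≠ ∞ := by
    rw [← lintegral_tsum fun n => (hm n).enorm]
    refine ne_top_of_le_ne_top ENNReal.one_ne_top ?_
    refine (lintegral_mono_ae (g := fun _ => 1) (hS.mono fun ω hω =>
      tsum_enorm_inner_mul_le_one hω (norm_displacement_le γ))).trans ?_
    simp
  have h := integral_tsum hm hfin
  refine Eq.trans ?_ h.symm
  exact tsum_congr fun n => (hT (ket n) (displacement γ (ket n))).2

/-- The characteristic functions of a family of operators with measurable matrix elements are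
jointly measurable, being series of products of matrix elements. -/
lemma aestronglyMeasurable_charFunction [IsProbabilityMeasure P] :
    AEStronglyMeasurable (fun p : Ω × ℂ => charFunction (S p.1) p.2) (P.prod volume) := by
  have hentry : ∀ (R : Op) (γ : ℂ) (n : ℕ), (inner ℂ (ket n) (R (displacement γ (ket n))) : ℂ)
      = ∑' m, (inner ℂ (ket m) (displacement γ (ket n)) : ℂ) * inner ℂ (ket n) (R (ket m)) := by
    intro R γ n
    have h := ((hasSum_smul_ket (displacement γ (ket n))).mapL R).mapL (innerSL ℂ (ket n))
    refine h.tsum_eq.symm.trans (tsum_congr fun m => ?_)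
    rw [innerSL_apply_apply, map_smul, inner_smul_right, inner_ket_left m]
  have : (fun p : Ω × ℂ => charFunction (S p.1) p.2) = fun p => ∑' n, ∑' m,
      (inner ℂ (ket m) (displacement p.2 (ket n)) : ℂ) * inner ℂ (ket n) (S p.1 (ket m)) := by
    funext p
    exact tsum_congr fun n => hentry (S p.1) p.2 n
  rw [this]
  refine AEMeasurable.aestronglyMeasurable (AEMeasurable.tsum fun n =>
    AEMeasurable.tsum fun m => ?_)
  exact ((measurable_inner_displacement_ket m n).comp measurable_snd).aemeasurable.mul
    (hT (ket n) (ket m)).1.aestronglyMeasurable.comp_fst.aemeasurable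

/-- Mixtures inherit the bound for the Wigner function, by Fubini's theorem and by Jensen's
inequality for the convex function `n ↦ exp (-2 n (1 + n))`. -/
lemma hasWignerBound [IsProbabilityMeasure P] (hS : ∀ᵐ ω ∂P, HasWignerBound (S ω)) :
    HasWignerBound T := by
  have hst : ∀ᵐ ω ∂P, IsState (S ω) := hS.mono fun _ h => h.isState
  have hpos : ∀ᵐ ω ∂P, (S ω).IsPositive := hst.mono fun _ h => h.1
  have hTst := hT.isState hst
  have hmeas := hT.aestronglyMeasurable_charFunction
  have hnint : Integrable (fun ω => ∫ γ, ‖charFunction (S ω) γ‖) P := by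
    refine Integrable.of_bound hmeas.norm.integral_prod_right' (2 * Real.pi) (hS.mono fun ω h => ?_)
    rw [Real.norm_of_nonneg (integral_nonneg fun _ => norm_nonneg _)]
    exact h.integral_norm_le
  have hint : Integrable (fun p : Ω × ℂ => charFunction (S p.1) p.2) (P.prod volume) :=
    (integrable_prod_iff hmeas).mpr ⟨hS.mono fun _ h => h.integrable, hnint⟩
  have hχ : charFunction T = fun γ => ∫ ω, charFunction (S ω) γ ∂P :=
    funext (hT.charFunction_eq hst)
  have hχint : Integrable (charFunction T) := hχ ▸ hint.integral_prod_right
  have hswap : wigner T 0 = ∫ ω, wigner (S ω) 0 ∂P := by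
    simp only [wigner_zero]
    rw [integral_const_mul, hχ, ← integral_integral_swap hint]
  have hWint : Integrable (fun ω => wigner (S ω) 0) P := by
    simp only [wigner_zero]
    exact hint.integral_prod_left.const_mul _
  have hre : (wigner T 0).re = ∫ ω, (wigner (S ω) 0).re ∂P := by
    rw [hswap]; exact (Complex.reCLM.integral_comp_comm hWint).symm
  have him : (wigner T 0).im = ∫ ω, (wigner (S ω) 0).im ∂P := by
    rw [hswap]; exact (Complex.imCLM.integral_comp_comm hWint).symm
  refine ⟨hTst, hχint, ?_, ?_, ?_, fun hn => ?_⟩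
  · calc ∫ γ, ‖charFunction T γ‖ ≤ ∫ γ, ∫ ω, ‖charFunction (S ω) γ‖ ∂P := by
          refine integral_mono hχint.norm hint.norm.integral_prod_right fun γ => ?_
          rw [hT.charFunction_eq hst]
          exact norm_integral_le_integral_norm _
      _ = ∫ ω, (∫ γ, ‖charFunction (S ω) γ‖) ∂P := (integral_integral_swap hint.norm).symm
      _ ≤ ∫ _, 2 * Real.pi ∂P :=
          integral_mono_ae hnint (integrable_const _) (hS.mono fun _ h => h.integral_norm_le)
      _ = 2 * Real.pi := by simp
  · rw [him, integral_congr_ae (g := fun _ => 0) (hS.mono fun _ h => h.im_eq_zero)]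
    simp
  · rw [hre]
    exact integral_nonneg_of_ae (hS.mono fun _ h => h.re_nonneg)
  · have hnm := hT.aemeasurable_meanPhoton
    rw [hT.meanPhoton_eq hpos] at hn ⊢
    have hfin := ae_lt_top' hnm hn
    rw [← integral_toReal hnm hfin, hre]
    have hcont : Continuous fun n : ℝ => 2 / Real.pi * Real.exp (-2 * n * (1 + n)) := by fun_prop
    have hle : ∀ᵐ ω ∂P, 2 / Real.pi * Real.exp (-2 * (meanPhoton (S ω)).toReal *
        (1 + (meanPhoton (S ω)).toReal)) ≤ (wigner (S ω) 0).re := by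
      filter_upwards [hS, hfin] with ω h hω using h.le_re hω.ne
    have hgint : Integrable (fun ω => 2 / Real.pi * Real.exp (-2 * (meanPhoton (S ω)).toReal *
        (1 + (meanPhoton (S ω)).toReal))) P := by
      refine hWint.re.mono' (hcont.measurable.comp_aemeasurable
        hnm.ennreal_toReal).aestronglyMeasurable (hle.mono fun ω h => ?_)
      rw [Real.norm_of_nonneg (by positivity)]
      exact h
    exact (convexOn_exp_neg_mul_one_add.map_integral_le hcont.continuousOn isClosed_Ici
      (Filter.Eventually.of_forall fun ω => ENNReal.toReal_nonneg)
      (integrable_toReal_of_lintegral_ne_top hnm hn) hgint).trans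
      (integral_mono_ae hgint hWint.re hle)

end IsEntrywiseIntegral

end Mixture

/-- A Gaussian map sends the Gaussian convex hull into the mixtures of Gaussian states. -/
lemma IsGaussianMap.hasWignerBound {E : traceClass →ₗ[ℂ] traceClass} (hE : IsGaussianMap E)
    {ρ : traceClass} (hρ : (ρ : Op) ∈ gaussianHull) : HasWignerBound (E ρ : Op) := by
  obtain ⟨hst, μ, hμ, hG, hint⟩ := hρ
  have hmix : IsEntrywiseIntegral μ (fun ψ => (E (projTC ψ) : Op)) (E ρ : Op) := fun x y =>
    hE.1.inner_map_mixture hst (hG.mono fun _ h => h.1) hint x y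
  exact hmix.hasWignerBound (hG.mono fun ψ h => (hE.2 (projTC ψ) h.2).hasWignerBound)

end SingleMode
end

open SingleMode
theorem proposition2 (ρ : traceClass) (hρ : (ρ : Op) ∈ gaussianHull)
    (E : traceClass →ₗ[ℂ] traceClass)
    (hE : IsGaussianMap E ∨ IsGaussianMapMixture.{u} E) :
    IsState (E ρ : Op) ∧
    MeasureTheory.Integrable (charFunction (E ρ : Op)) ∧
    (wigner (E ρ : Op) 0).im = 0 ∧
    (meanPhoton (E ρ : Op) ≠ ∞ →
      2 / Real.pi * Real.exp (-2 * (meanPhoton (E ρ : Op)).toReal *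
          (1 + (meanPhoton (E ρ : Op)).toReal))
        ≤ (wigner (E ρ : Op) 0).re) ∧
    (meanPhoton (E ρ : Op) = ∞ → 0 ≤ (wigner (E ρ : Op) 0).re) := by
  have h : HasWignerBound (E ρ : Op) := by
    rcases hE with hE | ⟨Ω, _, P, F, hP, hF, hmix⟩
    · exact hE.hasWignerBound hρ
    · have hint : IsEntrywiseIntegral P (fun ω => (F ω ρ : Op)) (E ρ : Op) := hmix ρ
      exact hint.hasWignerBound (Filter.Eventually.of_forall fun ω => (hF ω).hasWignerBound hρ)
  exact ⟨h.isState, h.integrable, h.im_eq_zero, h.le_re, fun _ => h.re_nonneg⟩
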